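/- **Setting.** Let $\Omega\subseteq\mathbb{R}^n$ be a domain (open and connected), let $S(m)$ be the space of real symmetric $m\times m$ matrices with the norm $\lVert X\rVert=\sqrt{\operatorname{tr}(X^TX)}$, and let $H\colon\Omega\to S(m)$. Let $\lambda_1(x)\le\cdots\le\lambda_m(x)$ be the eigenvalues of $H(x)$ repeated according to multiplicity, $P_i(x)$ the matrix of the orthogonal projection onto the eigenspace of $\lambda_i(x)$, $d_i(x)=\operatorname{tr}P_i(x)$, so that $H(x)=\sum_{i=1}^m\frac{\lambda_i(x)}{d_i(x)}P_i(x)$, and $$A_j(x)=\sum_{i:\ \lambda_i(x)\ne\lambda_j(x)}\frac{P_i(x)/d_i(x)}{\lambda_j(x)-\lambda_i(x)}.$$ For a function $F$ on $\Omega$ write $D_eF(x)=\lim_{h\to0}\frac{F(x+he)-F(x)}{h}$ (two-sided limit) for the directional derivative. $\nabla f$ denotes the Jacobian matrix of a vector-valued function $f$ (so gradients are row vectors), and for a matrix-valued $F$ and a fixed vector $q$, $\nabla_qF(x)$ denotes the Jacobian matrix of $y\mapsto F(y)q$ at $x$. **Theorem.** Let $j\in\{1,\dots,m\}$. (A) Assume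 that $H$ is continuous in $\Omega$. (i) $\lambda_j$ is continuous in $\Omega$. (ii) If $0<\alpha\le1$ and $\lVert H(x)-H(y)\rVert\le C|x-y|^\alpha$ for all $x,y\in\Omega$, then $|\lambda_j(x)-\lambda_j(y)|\le C|x-y|^\alpha$ for all $x,y\in\Omega$. (B) Assume that $H\in C^1(\Omega,S(m))$. (i) If $\operatorname{tr}P_j(x)=d_j$ is constant in $\Omega$, then for all $x\in\Omega$ and $e\in\mathbb{R}^n$ the directional derivative $D_e\lambda_j(x)$ exists and $$D_e\lambda_j(x)\,P_j(x)=P_j(x)\,D_eH(x)\,P_j(x),\qquad D_e\lambda_j(x)=\tfrac1{d_j}\operatorname{tr}\big(P_j(x)D_eH(x)\big),$$ $$D_e\lambda_j(x)=\xi^TD_eH(x)\,\xi=\xi^T\nabla_\xi H(x)\,e\quad\text{for every unit vector }\xi\in P_j(x)(\mathbb{R}^m).$$ (ii) The following conditions in $\Omega$ are equivalent: (a) $\lambda_j$ is $C^1$ and $\operatorname{tr}P_j$ is constant; (b) $\lambda_j$ is differentiable and $\operatorname{tr}P_j$ is constant; (c) $P_j$ is differentiable; (d) $P_j$ is continuous.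 If one of them holds, then for every $x\in\Omega$ the function $\lambda_j$ is differentiable at $x$, $$|\nabla\lambda_j(x)|\le\frac1{\sqrt{d_j(x)}}\max_{|e|=1}\lVert D_eH(x)\rVert,\qquad \nabla\lambda_j(x)=\xi^T\nabla_\xi H(x)\quad\text{for every unit vector }\xi\in P_j(x)(\mathbb{R}^m),$$ and $\nabla\lambda_j(x)e=D_e\lambda_j(x)=\frac1{d_j(x)}\operatorname{tr}\big(P_j(x)D_eH(x)\big)$ for every $e\in\mathbb{R}^n$. (For $n=0$ the maximum is read as $0$.) (C) Assume that $H\in C^2(\Omega,S(m))$. (i) Let $a\in\mathbb{R}^n$. If $\operatorname{tr}P_j(x)=d_j$ is constant in $\Omega$, then $D_a\lambda_j$ exists in $\Omega$ and, for all $x\in\Omega$ and $b\in\mathbb{R}^n$, $D_bD_a\lambda_j(x)$ exists and (everything evaluated at $x$) $$D_bD_a\lambda_j\,P_j=P_j\big(D_bD_aH+D_aH\,A_j\,D_bH+D_bH\,A_j\,D_aH\big)P_j,$$ $$D_bD_a\lambda_j=\tfrac1{d_j}\operatorname{tr}\big(P_j[D_bD_aH+2D_aH\,A_j\,D_bH]\big),$$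 $$D_bD_a\lambda_j=\xi^T\big(D_bD_aH+2D_aH\,A_j\,D_bH\big)\xi=a^T\big(\nabla_\xi(\nabla_\xi H)^T+2(\nabla_\xi H)^TA_j\nabla_\xi H\big)b$$ for every unit vector $\xi\in P_j(x)(\mathbb{R}^m)$. (ii) If one of the conditions (a)–(d) of (B)(ii) holds, then $\lambda_j$ is differentiable in $\Omega$ and its gradient $\nabla\lambda_j$ is differentiable in $\Omega$, and for every $x\in\Omega$ the Hessian $\mathcal{H}\lambda_j=\nabla(\nabla\lambda_j^T)$ satisfies $$\mathcal{H}\lambda_j(x)=\nabla_\xi(\nabla_\xi H)^T(x)+2(\nabla_\xi H(x))^TA_j(x)\nabla_\xi H(x)$$ for every unit vector $\xi\in P_j(x)(\mathbb{R}^m)$, and, for all $a,b\in\mathbb{R}^n$, $$a^T\mathcal{H}\lambda_j(x)b=D_bD_a\lambda_j(x)=\tfrac1{d_j(x)}\operatorname{tr}\big(P_j(x)[D_bD_aH(x)+2D_aH(x)A_j(x)D_bH(x)]\big).$$ -/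

import Mathlib

open scoped Matrix Matrix.Norms.Frobenius NNReal

namespace EigReg

noncomputable section

/-- The `j`-th eigenvalue of a symmetric real matrix `X`, in nondecreasing order and repeated
according to multiplicity (Mathlib's `eigenvalues₀` is nonincreasing, hence the reversal of the
index). The value is `0` for a matrix that is not symmetric. -/
def eigval {m : ℕ} (X : Matrix (Fin m) (Fin m) ℝ) (j : Fin m) : ℝ :=
  open Classical in
  if h : X.IsHermitian then h.eigenvalues₀ (Fin.cast (Fintype.card_fin m).symm j.rev) else 0

/-- The eigenspace `{ξ | X ξ = λ_j ξ}` of the `j`-th eigenvalue of `X`. -/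
def eigspace {m : ℕ} (X : Matrix (Fin m) (Fin m) ℝ) (j : Fin m) :
    Submodule ℝ (EuclideanSpace ℝ (Fin m)) :=
  Module.End.eigenspace (Matrix.toEuclideanLin X) (eigval X j)

/-- The eigenprojection `P_j`: the matrix of the orthogonal projection onto the eigenspace of the
`j`-th eigenvalue of `X`. -/
def eigproj {m : ℕ} (X : Matrix (Fin m) (Fin m) ℝ) (j : Fin m) : Matrix (Fin m) (Fin m) ℝ :=
  (Matrix.toEuclideanCLM (n := Fin m) (𝕜 := ℝ)).symm (eigspace X j).starProjection

/-- `A_j = ∑_{i : λ_i ≠ λ_j} (P_i / d_i) / (λ_j - λ_i)` with `d_i = tr P_i`, the pseudoinverse of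
`λ_j I - X`. -/
def pinv {m : ℕ} (X : Matrix (Fin m) (Fin m) ℝ) (j : Fin m) : Matrix (Fin m) (Fin m) ℝ :=
  open Classical in
  ∑ i ∈ Finset.univ.filter (fun i => eigval X i ≠ eigval X j),
    (eigval X j - eigval X i)⁻¹ • ((eigproj X i).trace⁻¹ • eigproj X i)

/-- The set `P(ℝ^m) ∩ S^{m-1}` of unit vectors in the range of `P`. -/
def unitRange {m : ℕ} (P : Matrix (Fin m) (Fin m) ℝ) : Set (Fin m → ℝ) :=
  {ξ | (∃ η : Fin m → ℝ, P *ᵥ η = ξ) ∧ ξ ⬝ᵥ ξ = 1}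

/-- The Jacobian matrix `∇f(x) ∈ ℝ^{k×n}` of a vector valued function on `ℝ^n`. -/
def jacobian {n k : ℕ} (f : EuclideanSpace ℝ (Fin n) → EuclideanSpace ℝ (Fin k))
    (x : EuclideanSpace ℝ (Fin n)) : Matrix (Fin k) (Fin n) ℝ :=
  Matrix.of fun i l => (fderiv ℝ f x (EuclideanSpace.single l 1)) i

/-- The Jacobian derivative `∇_q F(x) = ∇[F q](x) ∈ ℝ^{m×n}` of a matrix valued function
`F : ℝ^n → ℝ^{m×k}` for a fixed `q ∈ ℝ^k`. -/
def jacDeriv {n m k : ℕ} (q : Fin k → ℝ) (F : EuclideanSpace ℝ (Fin n) → Matrix (Fin m) (Fin k) ℝ)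
    (x : EuclideanSpace ℝ (Fin n)) : Matrix (Fin m) (Fin n) ℝ :=
  jacobian (fun y => WithLp.toLp 2 (F y *ᵥ q)) x

/-- The (two-sided) directional derivative `D_e F(x) = lim_{h → 0} (F(x + h e) - F(x)) / h` of a
matrix valued function. -/
abbrev dirD {n m k : ℕ} (e : EuclideanSpace ℝ (Fin n))
    (F : EuclideanSpace ℝ (Fin n) → Matrix (Fin m) (Fin k) ℝ)
    (x : EuclideanSpace ℝ (Fin n)) : Matrix (Fin m) (Fin k) ℝ :=
  lineDeriv ℝ F x e

/-- The second order term `∇_ξ(∇_ξ H)ᵀ(x) + 2 (∇_ξ H(x))ᵀ A_j(x) ∇_ξ H(x) ∈ ℝ^{n×n}`. -/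
def hessForm {n m : ℕ} (H : EuclideanSpace ℝ (Fin n) → Matrix (Fin m) (Fin m) ℝ) (j : Fin m)
    (ξ : Fin m → ℝ) (x : EuclideanSpace ℝ (Fin n)) : Matrix (Fin n) (Fin n) ℝ :=
  jacDeriv ξ (fun y => (jacDeriv ξ H y)ᵀ) x
    + (2 : ℝ) • ((jacDeriv ξ H x)ᵀ * pinv (H x) j * jacDeriv ξ H x)

/-- The four conditions on the `j`-th eigenvalue `λ_j` and eigenprojection `P_j` of `H` in `Ω`:
(a) `λ_j` is `C¹` and `P_j` has constant dimension, (b) `λ_j` is differentiable and `P_j` has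
constant dimension, (c) `P_j` is differentiable, (d) `P_j` is continuous. -/
def regConds {n m : ℕ} (Ω : Set (EuclideanSpace ℝ (Fin n)))
    (H : EuclideanSpace ℝ (Fin n) → Matrix (Fin m) (Fin m) ℝ) (j : Fin m) : List Prop :=
  [ContDiffOn ℝ 1 (fun y => eigval (H y) j) Ω ∧ ∃ d : ℝ, ∀ y ∈ Ω, (eigproj (H y) j).trace = d,
   DifferentiableOn ℝ (fun y => eigval (H y) j) Ω ∧
    ∃ d : ℝ, ∀ y ∈ Ω, (eigproj (H y) j).trace = d,
   DifferentiableOn ℝ (fun y => eigproj (H y) j) Ω,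
   ContinuousOn (fun y => eigproj (H y) j) Ω]

end

end EigReg

open EigReg

/-! Everything rests on comparing one symmetric matrix `X` with a nearby one `Y`. Write `P`, `Q` for
their `j`-th eigenprojections, `l`, `μ` for the eigenvalues, and `A` for the pseudoinverse of `l -
X`. A dimension count gives `|l - μ| ≤ ‖X - Y‖`, which is part (A). From `1 - P = A (l - X)` and `Y
Q = μ Q` one gets `(1 - P) Q = A ((l - μ) Q + (Y - X) Q)`, so `(1 - P) Q` is of order `‖Y - X‖`.
When the ranks agree, `P (1 - Q)` has the same norm, and together these blocks give `Q - P = A (Y -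
X) P + P (Y - X) A` up to a quadratic error (`norm_eigproj_sub_sub_le`). Thus constant multiplicity
makes the projection differentiable, although nothing is yet known about the eigenvalue. The exact
identity `(μ - l) P Q = P (Y - X) Q` then writes the eigenvalue difference as a quotient of traces,
and differentiating it yields `D_e λ P = P D_e H P`. Differentiating that relation and compressing
by `P` yields the second order formula, with `A` entering through the derivative of the projection
(`smul_eq_of_product_rule`). Conversely, a continuous projection has a continuous integer-valued
trace, which is constant on a connected set; this closes the cycle of equivalences. -/

namespace EigReg

/-! ### Spectral calculus for one symmetric matrix, and Weyl's inequality -/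

section Spectral

variable {m : ℕ} {X Y : Matrix (Fin m) (Fin m) ℝ}

theorem eigval_mono (hX : X.IsSymm) : Monotone (eigval X) := by
  have h : X.IsHermitian := by
    rwa [Matrix.IsHermitian, Matrix.conjTranspose_eq_transpose_of_trivial]
  intro i k hik
  simp only [eigval, h, dif_pos]
  exact h.eigenvalues₀_antitone (by simpa using hik)

/-- An orthogonal diagonalization with the eigenvalues in nondecreasing order. -/
theorem exists_orthogonal_diagonalization (hX : X.IsSymm) :
    ∃ U : Matrix (Fin m) (Fin m) ℝ, Uᵀ * U = 1 ∧ U * Uᵀ = 1 ∧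
      X = U * Matrix.diagonal (eigval X) * Uᵀ := by
  have h : X.IsHermitian := by
    rwa [Matrix.IsHermitian, Matrix.conjTranspose_eq_transpose_of_trivial]
  -- `eigenvalues` is `eigenvalues₀` read through `Fintype.equivOfCardEq`; `e` undoes that
  -- relabelling and reverses the order to match `eigval`.
  set e : Fin m ≃ Fin m := (Fintype.equivOfCardEq (Fintype.card_fin _)).symm.trans
    ((finCongr (Fintype.card_fin m)).trans Fin.revPerm) with he
  have hev : ∀ i, h.eigenvalues i = eigval X (e i) := by
    intro i
    simp only [eigval, h, dif_pos, Matrix.IsHermitian.eigenvalues]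
    congr 1
    simp [he]
  set V : Matrix (Fin m) (Fin m) ℝ := h.eigenvectorUnitary.1 with hV
  have hVV : V * Vᵀ = 1 := by
    have := Matrix.mem_unitaryGroup_iff.1 h.eigenvectorUnitary.2
    rwa [Matrix.star_eq_conjTranspose, Matrix.conjTranspose_eq_transpose_of_trivial] at this
  have hXV : X = V * Matrix.diagonal h.eigenvalues * Vᵀ := by
    have := h.spectral_theorem
    rw [Unitary.conjStarAlgAut_apply, Matrix.star_eq_conjTranspose,
      Matrix.conjTranspose_eq_transpose_of_trivial] at this
    exact this
  have key : V.submatrix id e.symm * (V.submatrix id e.symm)ᵀ = 1 := by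
    rw [Matrix.transpose_submatrix, Matrix.submatrix_mul_equiv, hVV, Matrix.submatrix_id_id]
  refine ⟨V.submatrix id e.symm, mul_eq_one_comm.1 key, key, ?_⟩
  have hd : Matrix.diagonal (eigval X) =
      (Matrix.diagonal h.eigenvalues).submatrix e.symm e.symm := by
    rw [Matrix.submatrix_diagonal_equiv]
    congr 1
    ext i
    simp [hev]
  rw [hd, Matrix.transpose_submatrix, Matrix.submatrix_mul_equiv, Matrix.submatrix_mul_equiv,
    ← hXV, Matrix.submatrix_id_id]

/-- If `X = U D Uᵀ`, then `Uᵀ X = D Uᵀ`. -/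
theorem transpose_mulVec_of_diagonalization {U : Matrix (Fin m) (Fin m) ℝ} (hU : Uᵀ * U = 1)
    (hX : X = U * Matrix.diagonal (eigval X) * Uᵀ) (w : Fin m → ℝ) (k : Fin m) :
    (Uᵀ *ᵥ (X *ᵥ w)) k = eigval X k * (Uᵀ *ᵥ w) k := by
  have : Uᵀ * X = Matrix.diagonal (eigval X) * Uᵀ := by
    conv_lhs => rw [hX]
    rw [← mul_assoc, ← mul_assoc, hU, one_mul]
  rw [Matrix.mulVec_mulVec, this, ← Matrix.mulVec_mulVec, Matrix.mulVec_diagonal]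

/-- The eigenprojection in terms of an orthogonal diagonalization. -/
theorem eigproj_eq_of_diagonalization {U : Matrix (Fin m) (Fin m) ℝ} (hU : Uᵀ * U = 1)
    (hU' : U * Uᵀ = 1) (hX : X = U * Matrix.diagonal (eigval X) * Uᵀ) (i : Fin m) :
    eigproj X i =
      U * Matrix.diagonal (fun k => if eigval X k = eigval X i then 1 else 0) * Uᵀ := by
  classical
  set D : Matrix (Fin m) (Fin m) ℝ :=
    Matrix.diagonal (fun k => if eigval X k = eigval X i then 1 else 0) with hD
  set M := U * D * Uᵀ with hM
  have hMM : M * M = M := by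
    have : D * D = D := by rw [hD, Matrix.diagonal_mul_diagonal]; congr 1; ext k; simp
    calc M * M = U * D * (Uᵀ * U) * D * Uᵀ := by simp only [hM, mul_assoc]
      _ = U * (D * D) * Uᵀ := by rw [hU]; simp only [mul_assoc, mul_one]
      _ = M := by rw [this]
  have hMT : Mᵀ = M := by
    simp [hM, hD, Matrix.transpose_mul, mul_assoc]
  have hXM : X * M = eigval X i • M := by
    have : Matrix.diagonal (eigval X) * D = eigval X i • D := by
      rw [hD, Matrix.diagonal_mul_diagonal, ← Matrix.diagonal_smul]
      congr 1; ext k; simp only [Pi.smul_apply, smul_eq_mul]; split_ifs with h <;> simp [h]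
    calc X * M = U * Matrix.diagonal (eigval X) * (Uᵀ * U) * D * Uᵀ := by
          conv_lhs => rw [hX]
          simp only [hM, mul_assoc]
      _ = U * (Matrix.diagonal (eigval X) * D) * Uᵀ := by rw [hU]; simp only [mul_assoc, mul_one]
      _ = eigval X i • M := by rw [this]; simp [hM]
  -- In the basis given by `U`, an eigenvector for `eigval X i` has zero coordinates wherever the
  -- eigenvalue differs, so the 0/1 diagonal leaves it unchanged.
  have hfix : ∀ w : Fin m → ℝ, X *ᵥ w = eigval X i • w → M *ᵥ w = w := by
    intro w hw
    have : D *ᵥ (Uᵀ *ᵥ w) = Uᵀ *ᵥ w := by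
      ext k
      have h1 := transpose_mulVec_of_diagonalization hU hX w k
      rw [hw, Matrix.mulVec_smul, Pi.smul_apply, smul_eq_mul] at h1
      rw [hD, Matrix.mulVec_diagonal]
      split_ifs with h
      · simp
      · rw [zero_mul]
        by_contra h2
        exact h (mul_right_cancel₀ (Ne.symm h2) h1.symm)
    rw [hM, ← Matrix.mulVec_mulVec, ← Matrix.mulVec_mulVec, this, Matrix.mulVec_mulVec, hU',
      Matrix.one_mulVec]
  rw [eigproj, StarAlgEquiv.symm_apply_eq]
  ext1 v
  refine (Submodule.eq_starProjection_of_mem_of_inner_eq_zero ?_ ?_)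
  · rw [eigspace, Module.End.mem_eigenspace_iff]
    apply (WithLp.equiv 2 _).injective
    show X *ᵥ (M *ᵥ v.ofLp) = eigval X i • (M *ᵥ v.ofLp)
    rw [Matrix.mulVec_mulVec, hXM, Matrix.smul_mulVec]
  · intro w hw
    rw [eigspace, Module.End.mem_eigenspace_iff] at hw
    have hw' : X *ᵥ w.ofLp = eigval X i • w.ofLp := congrArg WithLp.ofLp hw
    have h2 := hfix _ hw'
    rw [EuclideanSpace.inner_eq_star_dotProduct]
    show w.ofLp ⬝ᵥ (v.ofLp - M *ᵥ v.ofLp) = 0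
    rw [dotProduct_sub, sub_eq_zero]
    rw [Matrix.dotProduct_mulVec, ← Matrix.mulVec_transpose, hMT, h2]

/-- Matrices diagonal in one orthonormal basis multiply entrywise, so identities between `X`,
`eigproj` and `pinv` reduce to scalar ones on the spectrum. -/
theorem conj_diagonal_mul {U : Matrix (Fin m) (Fin m) ℝ} (hU : Uᵀ * U = 1) (f g : Fin m → ℝ) :
    U * Matrix.diagonal f * Uᵀ * (U * Matrix.diagonal g * Uᵀ) =
      U * Matrix.diagonal (fun k => f k * g k) * Uᵀ := by
  calc _ = U * Matrix.diagonal f * (Uᵀ * U) * Matrix.diagonal g * Uᵀ := by simp only [mul_assoc]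
    _ = _ := by rw [hU, ← Matrix.diagonal_mul_diagonal]; simp only [mul_assoc, mul_one]

theorem eigproj_transpose (hX : X.IsSymm) (j : Fin m) : (eigproj X j)ᵀ = eigproj X j := by
  obtain ⟨U, hU, hU', hUX⟩ := exists_orthogonal_diagonalization hX
  simp [eigproj_eq_of_diagonalization hU hU' hUX, Matrix.transpose_mul, mul_assoc]

theorem eigproj_mul_self (hX : X.IsSymm) (j : Fin m) :
    eigproj X j * eigproj X j = eigproj X j := by
  obtain ⟨U, hU, hU', hUX⟩ := exists_orthogonal_diagonalization hX
  rw [eigproj_eq_of_diagonalization hU hU' hUX, conj_diagonal_mul hU]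
  congr 3
  ext k
  split_ifs <;> simp

theorem mul_eigproj (hX : X.IsSymm) (j : Fin m) :
    X * eigproj X j = eigval X j • eigproj X j := by
  obtain ⟨U, hU, hU', hUX⟩ := exists_orthogonal_diagonalization hX
  rw [eigproj_eq_of_diagonalization hU hU' hUX]
  conv_lhs => enter [1]; rw [hUX]
  rw [conj_diagonal_mul hU, ← Matrix.smul_mul, ← Matrix.mul_smul, ← Matrix.diagonal_smul]
  congr 3
  ext k
  simp only [Pi.smul_apply, smul_eq_mul]
  split_ifs with h <;> simp [h]

theorem eigproj_mul (hX : X.IsSymm) (j : Fin m) :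
    eigproj X j * X = eigval X j • eigproj X j := by
  have := congrArg Matrix.transpose (mul_eigproj hX j)
  rwa [Matrix.transpose_mul, Matrix.transpose_smul, eigproj_transpose hX, hX.eq] at this

/-- The trace of the eigenprojection is the multiplicity of the eigenvalue. -/
theorem trace_eigproj (hX : X.IsSymm) (j : Fin m) :
    (eigproj X j).trace = (Finset.univ.filter fun k => eigval X k = eigval X j).card := by
  obtain ⟨U, hU, hU', hUX⟩ := exists_orthogonal_diagonalization hX
  rw [eigproj_eq_of_diagonalization hU hU' hUX, mul_assoc, Matrix.trace_mul_comm, mul_assoc, hU,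
    mul_one, Matrix.trace_diagonal]
  simp

theorem trace_eigproj_pos (hX : X.IsSymm) (j : Fin m) : 0 < (eigproj X j).trace := by
  rw [trace_eigproj hX, Nat.cast_pos, Finset.card_pos]
  exact ⟨j, by simp⟩

/-- Each eigenvalue is listed as often as its multiplicity, and the weights `1 / d_i` cancel this
repetition. On the eigenspace itself the entry is `0⁻¹ = 0`, which matches the omitted indices. -/
theorem pinv_eq_of_diagonalization {U : Matrix (Fin m) (Fin m) ℝ} (hX : X.IsSymm)
    (hU : Uᵀ * U = 1)
    (hU' : U * Uᵀ = 1) (hUX : X = U * Matrix.diagonal (eigval X) * Uᵀ) (j : Fin m) :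
    pinv X j = U * Matrix.diagonal (fun k => (eigval X j - eigval X k)⁻¹) * Uᵀ := by
  classical
  have hd : Matrix.diagonal (fun k => (eigval X j - eigval X k)⁻¹) =
      ∑ i ∈ Finset.univ.filter (fun i => eigval X i ≠ eigval X j),
        (eigval X j - eigval X i)⁻¹ • ((eigproj X i).trace⁻¹ •
          Matrix.diagonal (fun k => if eigval X k = eigval X i then (1 : ℝ) else 0)) := by
    simp only [← Matrix.diagonal_smul, trace_eigproj hX]
    refine Eq.trans ?_ (map_sum (Matrix.diagonalAddMonoidHom (Fin m) ℝ) _ _)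
    refine congrArg Matrix.diagonal ?_
    ext k
    rw [Finset.sum_apply]
    simp only [Pi.smul_apply, smul_eq_mul, mul_ite, mul_one, mul_zero]
    rw [← Finset.sum_filter, Finset.filter_filter]
    by_cases hk : eigval X k = eigval X j
    · rw [Finset.sum_eq_zero]
      · simp [hk]
      · intro i hi
        simp only [Finset.mem_filter, Finset.mem_univ, true_and] at hi
        exact absurd (hi.2.symm.trans hk) hi.1
    · have hs : (Finset.univ.filter fun i => eigval X i ≠ eigval X j ∧ eigval X k = eigval X i) =
          Finset.univ.filter fun i => eigval X i = eigval X k := by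
        ext i
        simp only [Finset.mem_filter, Finset.mem_univ, true_and]
        exact ⟨fun h => h.2.symm, fun h => ⟨h ▸ hk, h.symm⟩⟩
      rw [hs, Finset.sum_congr rfl (g := fun _ => (eigval X j - eigval X k)⁻¹ *
        ((Finset.univ.filter fun i => eigval X i = eigval X k).card : ℝ)⁻¹)]
      · have hpos : ((Finset.univ.filter fun i => eigval X i = eigval X k).card : ℝ) ≠ 0 := by
          rw [← trace_eigproj hX]; exact (trace_eigproj_pos hX k).ne'
        rw [Finset.sum_const, nsmul_eq_mul]
        field_simp
      · intro i hi
        simp only [Finset.mem_filter, Finset.mem_univ, true_and] at hi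
        rw [hi]
  rw [pinv, hd, Finset.mul_sum, Finset.sum_mul]
  refine Finset.sum_congr rfl fun i _ => ?_
  rw [Matrix.mul_smul, Matrix.mul_smul, Matrix.smul_mul, Matrix.smul_mul,
    ← eigproj_eq_of_diagonalization hU hU' hUX]

theorem pinv_transpose (hX : X.IsSymm) (j : Fin m) : (pinv X j)ᵀ = pinv X j := by
  obtain ⟨U, hU, hU', hUX⟩ := exists_orthogonal_diagonalization hX
  simp [pinv_eq_of_diagonalization hX hU hU' hUX, Matrix.transpose_mul, mul_assoc]

theorem pinv_mul_eigproj (hX : X.IsSymm) (j : Fin m) : pinv X j * eigproj X j = 0 := by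
  obtain ⟨U, hU, hU', hUX⟩ := exists_orthogonal_diagonalization hX
  rw [pinv_eq_of_diagonalization hX hU hU' hUX, eigproj_eq_of_diagonalization hU hU' hUX,
    conj_diagonal_mul hU]
  have : (fun k => (eigval X j - eigval X k)⁻¹ * if eigval X k = eigval X j then (1 : ℝ) else 0)
      = 0 := by
    ext k; split_ifs with h <;> simp [h]
  rw [this]; simp

theorem eigproj_mul_pinv (hX : X.IsSymm) (j : Fin m) : eigproj X j * pinv X j = 0 := by
  have := congrArg Matrix.transpose (pinv_mul_eigproj hX j)
  rwa [Matrix.transpose_mul, eigproj_transpose hX, pinv_transpose hX, Matrix.transpose_zero] at this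

theorem pinv_mul_sub (hX : X.IsSymm) (j : Fin m) :
    pinv X j * (eigval X j • 1 - X) = 1 - eigproj X j := by
  obtain ⟨U, hU, hU', hUX⟩ := exists_orthogonal_diagonalization hX
  have h1 : ∀ f : Fin m → ℝ, (∀ k, f k = 1) → U * Matrix.diagonal f * Uᵀ = 1 := by
    intro f hf
    rw [funext hf, Matrix.diagonal_one, mul_one, hU']
  rw [pinv_eq_of_diagonalization hX hU hU' hUX, eigproj_eq_of_diagonalization hU hU' hUX, mul_sub,
    mul_smul_comm, mul_one, eq_sub_iff_add_eq]
  conv_lhs => enter [1, 2, 2]; rw [hUX]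
  rw [conj_diagonal_mul hU, ← Matrix.smul_mul, ← Matrix.mul_smul, ← Matrix.sub_mul,
    ← Matrix.mul_sub, ← Matrix.add_mul, ← Matrix.mul_add, ← Matrix.diagonal_smul,
    Matrix.diagonal_sub, Matrix.diagonal_add]
  apply h1
  intro k
  simp only [Pi.smul_apply, smul_eq_mul]
  split_ifs with h
  · simp [h]
  · have : eigval X j - eigval X k ≠ 0 := sub_ne_zero.2 (Ne.symm h)
    field_simp
    ring

theorem sq_frobenius_norm {k l : ℕ} (M : Matrix (Fin k) (Fin l) ℝ) :
    ‖M‖ ^ 2 = ∑ i, ∑ j, M i j ^ 2 := by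
  rw [Matrix.frobenius_norm_def, ← Real.sqrt_eq_rpow, Real.sq_sqrt (by positivity)]
  simp

theorem sq_frobenius_norm_eq_trace {k l : ℕ} (M : Matrix (Fin k) (Fin l) ℝ) :
    ‖M‖ ^ 2 = (M * Mᵀ).trace := by
  rw [sq_frobenius_norm]
  simp [Matrix.trace, Matrix.mul_apply, sq]

/-- The Cauchy–Schwarz inequality for the Frobenius inner product. -/
theorem trace_mul_transpose_le {k l : ℕ} (M N : Matrix (Fin k) (Fin l) ℝ) :
    (M * Nᵀ).trace ≤ ‖M‖ * ‖N‖ := by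
  have h := Real.sum_mul_le_sqrt_mul_sqrt Finset.univ (fun p : Fin k × Fin l => M p.1 p.2)
    (fun p => N p.1 p.2)
  have e : ∀ M : Matrix (Fin k) (Fin l) ℝ, √(∑ p : Fin k × Fin l, M p.1 p.2 ^ 2) = ‖M‖ := by
    intro M
    rw [Fintype.sum_prod_type (f := fun p : Fin k × Fin l => M p.1 p.2 ^ 2)]
    exact (congrArg Real.sqrt (sq_frobenius_norm M).symm).trans (Real.sqrt_sq (norm_nonneg _))
  rw [e, e, Fintype.sum_prod_type] at h
  simpa [Matrix.trace, Matrix.mul_apply] using h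

/-- Cauchy–Schwarz against the rank-one matrix `v vᵀ`, whose Frobenius norm is `v ⬝ᵥ v`. -/
theorem dotProduct_mulVec_le (M : Matrix (Fin m) (Fin m) ℝ) (v : Fin m → ℝ) :
    v ⬝ᵥ (M *ᵥ v) ≤ ‖M‖ * (v ⬝ᵥ v) := by
  have h := trace_mul_transpose_le M (Matrix.vecMulVec v v)
  have h1 : (M * (Matrix.vecMulVec v v)ᵀ).trace = v ⬝ᵥ (M *ᵥ v) := by
    rw [Matrix.transpose_vecMulVec, Matrix.mul_vecMulVec, Matrix.trace_vecMulVec, dotProduct_comm]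
  have h2 : ‖Matrix.vecMulVec v v‖ = v ⬝ᵥ v := by
    have h0 : 0 ≤ v ⬝ᵥ v := Finset.sum_nonneg fun i _ => mul_self_nonneg _
    rw [← Real.sqrt_sq (norm_nonneg _), sq_frobenius_norm_eq_trace, Matrix.transpose_vecMulVec,
      Matrix.vecMulVec_mul_vecMulVec, Matrix.trace_vecMulVec, dotProduct_smul, smul_eq_mul,
      Real.sqrt_mul_self h0]
  rwa [h1, h2] at h

theorem dotProduct_mulVec_of_diagonalization {U : Matrix (Fin m) (Fin m) ℝ} (f : Fin m → ℝ)
    (hX : X = U * Matrix.diagonal f * Uᵀ) (v : Fin m → ℝ) :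
    v ⬝ᵥ (X *ᵥ v) = ∑ k, f k * (Uᵀ *ᵥ v) k ^ 2 := by
  rw [hX, ← Matrix.mulVec_mulVec, ← Matrix.mulVec_mulVec, Matrix.dotProduct_mulVec,
    ← Matrix.mulVec_transpose, dotProduct]
  refine Finset.sum_congr rfl fun k _ => ?_
  rw [Matrix.mulVec_diagonal]
  ring

/-- A Courant–Fischer argument: some nonzero `v` lies both in the span of the eigenvectors of `X`
with index at most `j` and in that of the eigenvectors of `Y` with index at least `j`. On it the
form of `X` is at most `eigval X j` and that of `Y` at least `eigval Y j`. -/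
theorem eigval_sub_le (hX : X.IsSymm) (hY : Y.IsSymm) (j : Fin m) :
    eigval Y j - eigval X j ≤ ‖Y - X‖ := by
  obtain ⟨U, hU, hU', hUX⟩ := exists_orthogonal_diagonalization hX
  obtain ⟨V, hV, hV', hVY⟩ := exists_orthogonal_diagonalization hY
  -- One linear condition for each `k ≠ j`, that is `m - 1` conditions on `m` unknowns, so the
  -- kernel is nontrivial.
  let F : (Fin m → ℝ) →ₗ[ℝ] ({k : Fin m // k ≠ j} → ℝ) :=
    LinearMap.pi fun k => if j < k.1 then (LinearMap.proj k.1).comp (Matrix.mulVecLin Uᵀ)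
      else (LinearMap.proj k.1).comp (Matrix.mulVecLin Vᵀ)
  have hF : LinearMap.ker F ≠ ⊥ := F.ker_ne_bot_of_finrank_lt <| by
    have := j.pos
    simp only [Module.finrank_fintype_fun_eq_card, Fintype.card_subtype_compl,
      Fintype.card_subtype_eq, Fintype.card_fin]
    omega
  obtain ⟨v, hv, hv0⟩ := Submodule.exists_mem_ne_zero_of_ne_bot hF
  have hFk : ∀ k (hk : k ≠ j), F v ⟨k, hk⟩ = 0 := fun k hk => by
    rw [LinearMap.mem_ker.1 hv]; rfl
  have hUk : ∀ k, j < k → (Uᵀ *ᵥ v) k = 0 := fun k hk => by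
    simpa [F, hk, Matrix.mulVec_transpose] using hFk k hk.ne'
  have hVk : ∀ k, k < j → (Vᵀ *ᵥ v) k = 0 := fun k hk => by
    simpa [F, hk.not_gt, Matrix.mulVec_transpose] using hFk k hk.ne
  have hpos : 0 < v ⬝ᵥ v := by
    have : 0 ≤ v ⬝ᵥ v := Finset.sum_nonneg fun i _ => mul_self_nonneg _
    exact this.lt_of_ne fun h => hv0 (dotProduct_self_eq_zero.1 h.symm)
  have hone : ∀ W : Matrix (Fin m) (Fin m) ℝ, W * Wᵀ = 1 →
      v ⬝ᵥ v = ∑ k, (Wᵀ *ᵥ v) k ^ 2 := by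
    intro W hW
    have := dotProduct_mulVec_of_diagonalization (X := 1) (U := W) 1 (by simpa using hW.symm) v
    simpa using this
  have h1 : v ⬝ᵥ (X *ᵥ v) ≤ eigval X j * (v ⬝ᵥ v) := by
    rw [dotProduct_mulVec_of_diagonalization _ hUX, hone U hU', Finset.mul_sum]
    refine Finset.sum_le_sum fun k _ => ?_
    rcases lt_or_ge j k with h | h
    · simp [hUk k h]
    · exact mul_le_mul_of_nonneg_right (eigval_mono hX h) (sq_nonneg _)
  have h2 : eigval Y j * (v ⬝ᵥ v) ≤ v ⬝ᵥ (Y *ᵥ v) := by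
    rw [dotProduct_mulVec_of_diagonalization _ hVY, hone V hV', Finset.mul_sum]
    refine Finset.sum_le_sum fun k _ => ?_
    rcases lt_or_ge k j with h | h
    · simp [hVk k h]
    · exact mul_le_mul_of_nonneg_right (eigval_mono hY h) (sq_nonneg _)
  have h3 := dotProduct_mulVec_le (Y - X) v
  rw [Matrix.sub_mulVec, dotProduct_sub] at h3
  refine le_of_mul_le_mul_right ?_ hpos
  linarith

/-- Weyl's perturbation inequality. -/
theorem abs_eigval_sub_le (hX : X.IsSymm) (hY : Y.IsSymm) (j : Fin m) :
    |eigval X j - eigval Y j| ≤ ‖X - Y‖ :=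
  abs_le.2 ⟨by have := eigval_sub_le hX hY j; rw [norm_sub_rev] at this; linarith,
    eigval_sub_le hY hX j⟩

end Spectral

open Filter Topology

/-! ### Perturbation estimates for eigenprojections of equal rank -/

section Estimates

variable {m : ℕ} {X Y P Q : Matrix (Fin m) (Fin m) ℝ}

/-- For orthogonal projections of equal rank, `(1 - P) Q` and `P (1 - Q)` have the same norm. -/
theorem norm_compl_mul_eq (hP : Pᵀ = P) (hPP : P * P = P) (hQ : Qᵀ = Q) (hQQ : Q * Q = Q)
    (htr : P.trace = Q.trace) : ‖(1 - P) * Q‖ = ‖P * (1 - Q)‖ := by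
  rw [← sq_eq_sq₀ (norm_nonneg _) (norm_nonneg _), sq_frobenius_norm_eq_trace,
    sq_frobenius_norm_eq_trace]
  have h1 : ((1 - P) * Q) * ((1 - P) * Q)ᵀ = Q - P * Q - Q * P + P * Q * P := by
    rw [Matrix.transpose_mul, Matrix.transpose_sub, hP, hQ, Matrix.transpose_one]
    calc (1 - P) * Q * (Q * (1 - P)) = (1 - P) * (Q * Q) * (1 - P) := by noncomm_ring
      _ = _ := by rw [hQQ]; noncomm_ring
  have h2 : (P * (1 - Q)) * (P * (1 - Q))ᵀ = P - P * Q * P := by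
    rw [Matrix.transpose_mul, Matrix.transpose_sub, hP, hQ, Matrix.transpose_one]
    calc P * (1 - Q) * ((1 - Q) * P) = P * P - P * Q * P - P * Q * P + P * (Q * Q) * P := by
          noncomm_ring
      _ = _ := by rw [hQQ, hPP]; noncomm_ring
  have h3 : (P * Q * P).trace = (P * Q).trace := by
    rw [Matrix.trace_mul_comm, ← mul_assoc, hPP]
  -- The squared norms are `tr Q - tr (P Q)` and `tr P - tr (P Q)`; equality of the ranks enters
  -- only here.
  rw [h1, h2, Matrix.trace_add, Matrix.trace_sub, Matrix.trace_sub, Matrix.trace_sub, h3,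
    Matrix.trace_mul_comm Q P, htr]
  ring

/-- Replace `1 - P` by `A (l - X)` and use that `Y` acts on its eigenprojection as a scalar. No
spectral gap of `Y` is involved. -/
theorem compl_eigproj_mul (hX : X.IsSymm) (hY : Y.IsSymm) (j : Fin m) :
    (1 - eigproj X j) * eigproj Y j =
      pinv X j * ((eigval X j - eigval Y j) • eigproj Y j + (Y - X) * eigproj Y j) := by
  rw [← pinv_mul_sub hX, mul_assoc]
  congr 1
  rw [sub_mul, sub_mul, smul_mul_assoc, one_mul, mul_eigproj hY, sub_smul]
  abel

theorem norm_eigproj (hX : X.IsSymm) (j : Fin m) : ‖eigproj X j‖ = √(eigproj X j).trace := by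
  rw [← Real.sqrt_sq (norm_nonneg _), sq_frobenius_norm_eq_trace, eigproj_transpose hX,
    eigproj_mul_self hX]

theorem norm_compl_eigproj_mul_le (hX : X.IsSymm) (hY : Y.IsSymm) (j : Fin m)
    (htr : (eigproj Y j).trace = (eigproj X j).trace) :
    ‖(1 - eigproj X j) * eigproj Y j‖ ≤ 2 * ‖pinv X j‖ * ‖eigproj X j‖ * ‖Y - X‖ := by
  have hn : ‖eigproj Y j‖ = ‖eigproj X j‖ := by rw [norm_eigproj hX, norm_eigproj hY, htr]
  rw [compl_eigproj_mul hX hY]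
  calc _ ≤ ‖pinv X j‖ * (‖(eigval X j - eigval Y j) • eigproj Y j‖
          + ‖(Y - X) * eigproj Y j‖) :=
        (norm_mul_le _ _).trans (by gcongr; exact norm_add_le _ _)
    _ ≤ ‖pinv X j‖ * (‖Y - X‖ * ‖eigproj X j‖ + ‖Y - X‖ * ‖eigproj X j‖) := by
        gcongr
        · rw [norm_smul, hn, Real.norm_eq_abs]
          gcongr
          rw [norm_sub_rev]
          exact abs_eigval_sub_le hX hY j
        · rw [← hn]; exact norm_mul_le _ _
    _ = _ := by ring

/-- `Q - P = (1 - P) Q - P (1 - Q)`, and both blocks have the same norm. The constant depends on `X`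
alone, so the bound is uniform in `Y`. -/
theorem norm_eigproj_sub_le (hX : X.IsSymm) (hY : Y.IsSymm) (j : Fin m)
    (htr : (eigproj Y j).trace = (eigproj X j).trace) :
    ‖eigproj Y j - eigproj X j‖ ≤ 2 * (2 * ‖pinv X j‖ * ‖eigproj X j‖ * ‖Y - X‖) := by
  have h := norm_compl_eigproj_mul_le hX hY j htr
  have h' := norm_compl_mul_eq (eigproj_transpose hX j) (eigproj_mul_self hX j)
    (eigproj_transpose hY j) (eigproj_mul_self hY j) htr.symm
  have e : eigproj Y j - eigproj X j =
      (1 - eigproj X j) * eigproj Y j - eigproj X j * (1 - eigproj Y j) := by noncomm_ring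
  rw [e]
  refine (norm_sub_le _ _).trans ?_
  rw [← h']
  linarith

/-- First order expansion of the eigenprojection under perturbations that keep its rank. -/
theorem norm_eigproj_sub_sub_le (hX : X.IsSymm) (hY : Y.IsSymm) (j : Fin m)
    (htr : (eigproj Y j).trace = (eigproj X j).trace) :
    ‖eigproj Y j - eigproj X j
        - (pinv X j * (Y - X) * eigproj X j + eigproj X j * (Y - X) * pinv X j)‖ ≤
      24 * (‖pinv X j‖ * ‖pinv X j‖ * ‖eigproj X j‖ * (1 + ‖eigproj X j‖)) * ‖Y - X‖ ^ 2 := by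
  have hE := norm_compl_eigproj_mul_le hX hY j htr
  have hG := hE
  rw [norm_compl_mul_eq (eigproj_transpose hX j) (eigproj_mul_self hX j)
    (eigproj_transpose hY j) (eigproj_mul_self hY j) htr.symm] at hG
  have hQP := norm_eigproj_sub_le hX hY j htr
  have hlam := abs_eigval_sub_le hX hY j
  rw [norm_sub_rev] at hlam
  have hEeq := compl_eigproj_mul hX hY j
  have hAP := pinv_mul_eigproj hX j
  have hPt := eigproj_transpose hX j
  have hQt := eigproj_transpose hY j
  have hPP := eigproj_mul_self hX j
  have hQQ := eigproj_mul_self hY j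
  have hAt := pinv_transpose hX j
  have hDt : (Y - X)ᵀ = Y - X := by rw [Matrix.transpose_sub, hX.eq, hY.eq]
  set P := eigproj X j
  set Q := eigproj Y j
  set A := pinv X j
  set D := Y - X
  set s := eigval X j - eigval Y j
  clear_value P Q A D s
  set F := A * (s • (Q - P)) + A * D * (Q - P) with hF
  set E := (1 - P) * Q with hEdef
  set G := P * (1 - Q) with hGdef
  have hEF : E = A * D * P + F := by
    have h : A * s • (Q - P) = A * s • Q := by
      rw [smul_sub, mul_sub, mul_smul_comm s A P, hAP, smul_zero, sub_zero]
    rw [hEeq, hF, h, mul_add, mul_sub, ← mul_assoc]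
    abel
  have hEt : Eᵀ = P * D * A + Fᵀ := by
    rw [hEF, Matrix.transpose_add, Matrix.transpose_mul, Matrix.transpose_mul, hPt, hDt, hAt,
      mul_assoc]
  have hEEt : E * Eᵀ = (1 - P) * Q * (1 - P) := by
    rw [hEdef, Matrix.transpose_mul, Matrix.transpose_sub, hPt, hQt, Matrix.transpose_one]
    calc (1 - P) * Q * (Q * (1 - P)) = (1 - P) * (Q * Q) * (1 - P) := by noncomm_ring
      _ = _ := by rw [hQQ]
  have hGGt : G * Gᵀ = P - P * Q * P := by
    rw [hGdef, Matrix.transpose_mul, Matrix.transpose_sub, hPt, hQt, Matrix.transpose_one]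
    calc P * (1 - Q) * ((1 - Q) * P) = P * P - P * Q * P - P * Q * P + P * (Q * Q) * P := by
          noncomm_ring
      _ = _ := by rw [hQQ, hPP]; noncomm_ring
  have hEt' : Eᵀ = Q * (1 - P) := by
    rw [hEdef, Matrix.transpose_mul, Matrix.transpose_sub, hPt, hQt, Matrix.transpose_one]
  -- The diagonal blocks of `Q - P` relative to `P` are `E Eᵀ` and `-G Gᵀ`, hence quadratically
  -- small; the first order part sits in the off-diagonal blocks.
  have hR : Q - P - (A * D * P + P * D * A) = F + Fᵀ - E * Eᵀ - G * Gᵀ := by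
    have h1 : Q - P = E + Eᵀ - E * Eᵀ - G * Gᵀ := by
      rw [hEEt, hGGt, hEt', hEdef]; noncomm_ring
    rw [h1, hEt]
    nth_rewrite 1 [hEF]
    abel
  have hFn : ‖F‖ ≤ 2 * ‖A‖ * ‖D‖ * (2 * (2 * ‖A‖ * ‖P‖ * ‖D‖)) := by
    calc ‖F‖ ≤ ‖A‖ * (‖D‖ * ‖Q - P‖) + ‖A‖ * ‖D‖ * ‖Q - P‖ := by
          refine (norm_add_le _ _).trans (add_le_add ?_ ?_)
          · refine (norm_mul_le _ _).trans ?_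
            gcongr
            rw [norm_smul, Real.norm_eq_abs]
            gcongr
          · refine (norm_mul_le _ _).trans ?_
            gcongr
            exact norm_mul_le _ _
      _ = 2 * ‖A‖ * ‖D‖ * ‖Q - P‖ := by ring
      _ ≤ _ := by gcongr
  have hsq : ∀ M : Matrix (Fin m) (Fin m) ℝ, ‖M‖ ≤ 2 * ‖A‖ * ‖P‖ * ‖D‖ →
      ‖M * Mᵀ‖ ≤ (2 * ‖A‖ * ‖P‖ * ‖D‖) ^ 2 := by
    intro M hM
    refine (norm_mul_le _ _).trans ?_
    rw [Matrix.frobenius_norm_transpose, ← sq]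
    gcongr
  rw [hR]
  have h1 := norm_sub_le (F + Fᵀ - E * Eᵀ) (G * Gᵀ)
  have h2 := norm_sub_le (F + Fᵀ) (E * Eᵀ)
  have h3 := norm_add_le F Fᵀ
  rw [Matrix.frobenius_norm_transpose] at h3
  have h4 := hsq E hE
  have h5 := hsq G hG
  have h6 : 0 ≤ ‖A‖ * ‖A‖ * ‖P‖ * ‖D‖ ^ 2 := by positivity
  have h7 : 0 ≤ ‖A‖ * ‖A‖ * ‖P‖ * ‖P‖ * ‖D‖ ^ 2 := by positivity
  -- The right side is `(16 p + 8 p²) a² d²` with `a = ‖A‖`, `p = ‖P‖`, `d = ‖D‖`; the constant 24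
  -- covers both coefficients.
  have h8 : ‖F + Fᵀ - E * Eᵀ - G * Gᵀ‖ ≤ 2 * (2 * ‖A‖ * ‖D‖ * (2 * (2 * ‖A‖ * ‖P‖ * ‖D‖)))
      + 2 * (2 * ‖A‖ * ‖P‖ * ‖D‖) ^ 2 := by linarith
  refine h8.trans ?_
  clear h8 h5 h4 h3 h2 h1 hsq hFn hE hG hQP hlam
  generalize ‖A‖ = a at *
  generalize ‖P‖ = p at *
  generalize ‖D‖ = d at *
  linarith

end Estimates

/-! ### First derivatives of the eigenprojection and the eigenvalue -/

section Derivatives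

variable {V : Type*} [NormedAddCommGroup V] [NormedSpace ℝ V] {m : ℕ}
  {H : V → Matrix (Fin m) (Fin m) ℝ} {H' : V →L[ℝ] Matrix (Fin m) (Fin m) ℝ} {x : V} {j : Fin m}

/-- The eigenprojection is differentiable where its rank is locally constant. -/
theorem hasFDerivAt_eigproj (hH : HasFDerivAt H H' x) (hs : ∀ᶠ y in 𝓝 x, (H y).IsSymm)
    (htr : ∀ᶠ y in 𝓝 x, (eigproj (H y) j).trace = (eigproj (H x) j).trace) :
    HasFDerivAt (fun y => eigproj (H y) j)
      ((ContinuousLinearMap.mulLeftRight ℝ (Matrix (Fin m) (Fin m) ℝ) (pinv (H x) j)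
          (eigproj (H x) j)
        + ContinuousLinearMap.mulLeftRight ℝ (Matrix (Fin m) (Fin m) ℝ) (eigproj (H x) j)
          (pinv (H x) j)).comp H') x := by
  set L := ContinuousLinearMap.mulLeftRight ℝ (Matrix (Fin m) (Fin m) ℝ) (pinv (H x) j)
          (eigproj (H x) j)
        + ContinuousLinearMap.mulLeftRight ℝ (Matrix (Fin m) (Fin m) ℝ) (eigproj (H x) j)
          (pinv (H x) j) with hL
  have hLH : HasFDerivAt (fun y => L (H y)) (L.comp H') x := L.hasFDerivAt.comp x hH
  -- The remainder is `O(‖H y - H x‖²)`, hence `O(‖y - x‖²)`, so its derivative at `x` vanishes.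
  have hO : HasFDerivAt (fun y => eigproj (H y) j - eigproj (H x) j - L (H y - H x))
      (0 : V →L[ℝ] Matrix (Fin m) (Fin m) ℝ) x := by
    have h1 : (fun y => H y - H x) =O[𝓝 x] fun y => y - x := hH.isBigO_sub
    refine Asymptotics.IsBigO.hasFDerivAt (n := 2) ?_ one_lt_two
    refine Asymptotics.IsBigO.trans ?_ (h1.norm_norm.pow 2)
    refine Asymptotics.IsBigO.of_bound (24 * (‖pinv (H x) j‖ * ‖pinv (H x) j‖ *
      ‖eigproj (H x) j‖ * (1 + ‖eigproj (H x) j‖))) ?_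
    filter_upwards [hs, htr] with y hy hty
    have := norm_eigproj_sub_sub_le hs.self_of_nhds hy j hty
    rw [norm_pow, norm_norm]
    simpa [hL, ContinuousLinearMap.mulLeftRight_apply] using this
  refine HasFDerivAt.congr_of_eventuallyEq (((hO.add hLH).add_const
    (eigproj (H x) j - L (H x))).congr_fderiv (zero_add _)) (Eventually.of_forall fun y => ?_)
  simp only [Pi.add_apply, map_sub]
  abel

theorem fderiv_eigproj_apply (hH : DifferentiableAt ℝ H x) (hs : ∀ᶠ y in 𝓝 x, (H y).IsSymm)
    (htr : ∀ᶠ y in 𝓝 x, (eigproj (H y) j).trace = (eigproj (H x) j).trace) (e : V) :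
    fderiv ℝ (fun y => eigproj (H y) j) x e =
      pinv (H x) j * fderiv ℝ H x e * eigproj (H x) j
        + eigproj (H x) j * fderiv ℝ H x e * pinv (H x) j := by
  exact DFunLike.congr_fun (hasFDerivAt_eigproj hH.hasFDerivAt hs htr).fderiv e

/-- `X` acts as a scalar to the right of its projection and `Y` as a scalar to the left of its own.
The identity is exact and holds without any rank assumption. -/
theorem eigval_sub_smul {X Y : Matrix (Fin m) (Fin m) ℝ} (hX : X.IsSymm) (hY : Y.IsSymm)
    (j : Fin m) : (eigval Y j - eigval X j) • (eigproj X j * eigproj Y j) =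
      eigproj X j * (Y - X) * eigproj Y j := by
  rw [mul_sub, sub_mul, eigproj_mul hX, mul_assoc, mul_eigproj hY, mul_smul_comm, smul_mul_assoc,
    sub_smul]

/-- The eigenvalue is differentiable where its multiplicity is locally constant. -/
theorem differentiableAt_eigval (hH : DifferentiableAt ℝ H x) (hs : ∀ᶠ y in 𝓝 x, (H y).IsSymm)
    (htr : ∀ᶠ y in 𝓝 x, (eigproj (H y) j).trace = (eigproj (H x) j).trace) :
    DifferentiableAt ℝ (fun y => eigval (H y) j) x := by
  have hx : (H x).IsSymm := hs.self_of_nhds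
  have hP := (hasFDerivAt_eigproj hH.hasFDerivAt hs htr).differentiableAt
  let T : Matrix (Fin m) (Fin m) ℝ →L[ℝ] ℝ :=
    (Matrix.traceLinearMap (Fin m) ℝ ℝ).toContinuousLinearMap
  have hT : ∀ M, T M = M.trace := fun M => rfl
  -- After taking traces, the eigenvalue difference is a quotient whose denominator at `x` is `tr P
  -- > 0`.
  have hden : DifferentiableAt ℝ (fun y => T (eigproj (H x) j * eigproj (H y) j)) x :=
    T.differentiableAt.comp x (hP.const_mul _)
  have hnum : DifferentiableAt ℝ
      (fun y => T (eigproj (H x) j * (H y - H x) * eigproj (H y) j)) x :=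
    T.differentiableAt.comp x (((hH.sub_const _).const_mul _).mul hP)
  have hden0 : T (eigproj (H x) j * eigproj (H x) j) ≠ 0 := by
    rw [hT, eigproj_mul_self hx]; exact (trace_eigproj_pos hx j).ne'
  have hq : DifferentiableAt ℝ (fun y => T (eigproj (H x) j * (H y - H x) * eigproj (H y) j) /
      T (eigproj (H x) j * eigproj (H y) j)) x := by
    simp only [div_eq_mul_inv]
    exact hnum.fun_mul (DifferentiableAt.fun_inv (h := fun y =>
      T (eigproj (H x) j * eigproj (H y) j)) hden hden0)
  refine (hq.const_add (eigval (H x) j)).congr_of_eventuallyEq ?_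
  filter_upwards [hs, hden.continuousAt.eventually_ne hden0] with y hy hy0
  have := congrArg T (eigval_sub_smul hx hy j)
  rw [map_smul, smul_eq_mul] at this
  rw [← this, mul_div_cancel_right₀ _ hy0]
  ring

/-- Differentiate `eigval_sub_smul` in its second matrix at `y = x`: each term with the derivative
of the projection carries a factor that vanishes at `x`. -/
theorem fderiv_eigval_smul (hH : DifferentiableAt ℝ H x) (hs : ∀ᶠ y in 𝓝 x, (H y).IsSymm)
    (htr : ∀ᶠ y in 𝓝 x, (eigproj (H y) j).trace = (eigproj (H x) j).trace) (e : V) :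
    fderiv ℝ (fun y => eigval (H y) j) x e • eigproj (H x) j =
      eigproj (H x) j * fderiv ℝ H x e * eigproj (H x) j := by
  have hx : (H x).IsSymm := hs.self_of_nhds
  have hP := (hasFDerivAt_eigproj hH.hasFDerivAt hs htr).differentiableAt.hasFDerivAt
  have hl := (differentiableAt_eigval hH hs htr).hasFDerivAt
  have h1 := (hl.sub_const (eigval (H x) j)).smul (hP.const_mul (eigproj (H x) j))
  have h2 := ((hH.hasFDerivAt.sub_const (H x)).const_mul (eigproj (H x) j)).mul' hP
  have h3 := h2.congr_of_eventuallyEq (f₁ := fun y => (eigval (H y) j - eigval (H x) j) •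
    (eigproj (H x) j * eigproj (H y) j)) (by
      filter_upwards [hs] with y hy using eigval_sub_smul hx hy j)
  have := congrArg (fun L : V →L[ℝ] Matrix (Fin m) (Fin m) ℝ => L e) (h1.unique h3)
  change (eigval (H x) j - eigval (H x) j) •
      (eigproj (H x) j * fderiv ℝ (fun y => eigproj (H y) j) x e) +
      fderiv ℝ (fun y => eigval (H y) j) x e • (eigproj (H x) j * eigproj (H x) j) =
    eigproj (H x) j * (H x - H x) * fderiv ℝ (fun y => eigproj (H y) j) x e +
      eigproj (H x) j * fderiv ℝ H x e * eigproj (H x) j at this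
  simpa [eigproj_mul_self hx] using this

theorem fderiv_eigval_apply (hH : DifferentiableAt ℝ H x) (hs : ∀ᶠ y in 𝓝 x, (H y).IsSymm)
    (htr : ∀ᶠ y in 𝓝 x, (eigproj (H y) j).trace = (eigproj (H x) j).trace) (e : V) :
    fderiv ℝ (fun y => eigval (H y) j) x e =
      1 / (eigproj (H x) j).trace * (eigproj (H x) j * fderiv ℝ H x e).trace := by
  have hx : (H x).IsSymm := hs.self_of_nhds
  have h := congrArg Matrix.trace (fderiv_eigval_smul hH hs htr e)
  rw [Matrix.trace_smul, smul_eq_mul, mul_assoc, Matrix.trace_mul_comm, mul_assoc,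
    eigproj_mul_self hx, Matrix.trace_mul_comm (fderiv ℝ H x e)] at h
  have := (trace_eigproj_pos hx j).ne'
  rw [← h]
  field_simp

end Derivatives

/-! ### Jacobian matrices versus Fréchet derivatives -/

section Jacobian

variable {n m k : ℕ}

theorem jacobian_mulVec (f : EuclideanSpace ℝ (Fin n) → EuclideanSpace ℝ (Fin k))
    (x e : EuclideanSpace ℝ (Fin n)) : jacobian f x *ᵥ e.ofLp = (fderiv ℝ f x e).ofLp := by
  have he : e = ∑ l, e l • EuclideanSpace.single l (1 : ℝ) := by
    ext i
    simp [Finset.sum_apply, Pi.single_apply]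
  ext i
  conv_rhs => rw [he, map_sum]
  simp [jacobian, Matrix.mulVec, dotProduct, mul_comm]

theorem dotProduct_jacobian_mulVec {f : EuclideanSpace ℝ (Fin n) → EuclideanSpace ℝ (Fin k)}
    {x : EuclideanSpace ℝ (Fin n)} (hf : DifferentiableAt ℝ f x) (a : EuclideanSpace ℝ (Fin k))
    (b : EuclideanSpace ℝ (Fin n)) :
    a.ofLp ⬝ᵥ (jacobian f x *ᵥ b.ofLp) = fderiv ℝ (fun y => a.ofLp ⬝ᵥ (f y).ofLp) x b := by
  have h : (fun y => a.ofLp ⬝ᵥ (f y).ofLp) = fun y => innerSL ℝ a (f y) := by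
    ext y
    rw [innerSL_apply_apply, EuclideanSpace.inner_eq_star_dotProduct, dotProduct_comm]
    simp
  have h' : HasFDerivAt (fun y => innerSL ℝ a (f y)) ((innerSL ℝ a).comp (fderiv ℝ f x)) x :=
    (innerSL ℝ a).hasFDerivAt.comp x hf.hasFDerivAt
  rw [jacobian_mulVec, h, h'.fderiv, ContinuousLinearMap.comp_apply, innerSL_apply_apply,
    EuclideanSpace.inner_eq_star_dotProduct, dotProduct_comm]
  simp

/-- `M ↦ M q` as a continuous linear map. -/
noncomputable def mulVecRightCLM (q : Fin k → ℝ) :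
    Matrix (Fin m) (Fin k) ℝ →L[ℝ] EuclideanSpace ℝ (Fin m) :=
  LinearMap.toContinuousLinearMap
    { toFun := fun M => WithLp.toLp 2 (M *ᵥ q)
      map_add' := fun M N => by rw [Matrix.add_mulVec]; rfl
      map_smul' := fun c M => by rw [Matrix.smul_mulVec]; rfl }

theorem jacDeriv_mulVec {F : EuclideanSpace ℝ (Fin n) → Matrix (Fin m) (Fin k) ℝ}
    {x : EuclideanSpace ℝ (Fin n)} (hF : DifferentiableAt ℝ F x) (q : Fin k → ℝ)
    (e : EuclideanSpace ℝ (Fin n)) :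
    jacDeriv q F x *ᵥ e.ofLp = fderiv ℝ F x e *ᵥ q := by
  rw [jacDeriv, jacobian_mulVec]
  have h := ((mulVecRightCLM (m := m) q).hasFDerivAt.comp x hF.hasFDerivAt).fderiv
  exact congrArg WithLp.ofLp (DFunLike.congr_fun h e)

/-- `M ↦ ξᵀ M ξ` as a continuous linear map. -/
noncomputable def quadCLM (ξ : Fin m → ℝ) : Matrix (Fin m) (Fin m) ℝ →L[ℝ] ℝ :=
  LinearMap.toContinuousLinearMap
    { toFun := fun M => ξ ⬝ᵥ (M *ᵥ ξ)
      map_add' := fun M N => by rw [Matrix.add_mulVec, dotProduct_add]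
      map_smul' := fun c M => by rw [Matrix.smul_mulVec, dotProduct_smul]; rfl }

/-- The trace as a continuous linear map. -/
noncomputable def traceCLM (m : ℕ) : Matrix (Fin m) (Fin m) ℝ →L[ℝ] ℝ :=
  (Matrix.traceLinearMap (Fin m) ℝ ℝ).toContinuousLinearMap

/-- The transposition as a continuous linear map. -/
noncomputable def transposeCLM (m : ℕ) :
    Matrix (Fin m) (Fin m) ℝ →L[ℝ] Matrix (Fin m) (Fin m) ℝ :=
  LinearMap.toContinuousLinearMap
    { toFun := fun M => Mᵀ
      map_add' := fun _ _ => rfl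
      map_smul' := fun _ _ => rfl }

theorem eq_of_dotProduct_mulVec_eq {M N : Matrix (Fin m) (Fin k) ℝ}
    (h : ∀ (a : EuclideanSpace ℝ (Fin m)) (b : EuclideanSpace ℝ (Fin k)),
      a.ofLp ⬝ᵥ (M *ᵥ b.ofLp) = a.ofLp ⬝ᵥ (N *ᵥ b.ofLp)) : M = N := by
  ext i l
  simpa using h (EuclideanSpace.single i 1) (EuclideanSpace.single l 1)

theorem isSymm_fderiv_apply {V : Type*} [NormedAddCommGroup V] [NormedSpace ℝ V]
    {H : V → Matrix (Fin m) (Fin m) ℝ} {x : V} (hH : DifferentiableAt ℝ H x)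
    (hs : ∀ᶠ y in 𝓝 x, (H y).IsSymm) (e : V) : (fderiv ℝ H x e).IsSymm := by
  have h1 : HasFDerivAt (fun y => (H y)ᵀ) ((transposeCLM m).comp (fderiv ℝ H x)) x :=
    (transposeCLM m).hasFDerivAt.comp x hH.hasFDerivAt
  have h2 := h1.congr_of_eventuallyEq (f₁ := H) (by filter_upwards [hs] with y hy using hy.symm)
  exact DFunLike.congr_fun (h2.unique hH.hasFDerivAt) e

end Jacobian

/-! ### Scalar formulas from compressed matrix equations -/

section UnitRange

variable {m : ℕ} {P M : Matrix (Fin m) (Fin m) ℝ} {ξ : Fin m → ℝ}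

theorem mulVec_eq_self_of_mem_unitRange (hPP : P * P = P) (hξ : ξ ∈ unitRange P) :
    P *ᵥ ξ = ξ := by
  obtain ⟨⟨η, rfl⟩, -⟩ := hξ
  rw [Matrix.mulVec_mulVec, hPP]

/-- Evaluate both quadratic forms at `ξ`, which `P` fixes. This and `eq_trace_of_smul_eq` serve the
first and the second order formulas alike. -/
theorem eq_dotProduct_of_smul_eq (hP : Pᵀ = P) (hPP : P * P = P) (hξ : ξ ∈ unitRange P) {s : ℝ}
    (h : s • P = P * M * P) : s = ξ ⬝ᵥ (M *ᵥ ξ) := by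
  have hPξ := mulVec_eq_self_of_mem_unitRange hPP hξ
  have := congrArg (fun N => ξ ⬝ᵥ (N *ᵥ ξ)) h
  simp only [Matrix.smul_mulVec, ← Matrix.mulVec_mulVec, hPξ, dotProduct_smul, hξ.2] at this
  rw [Matrix.dotProduct_mulVec, ← Matrix.mulVec_transpose, hP, hPξ] at this
  simpa using this

theorem eq_trace_of_smul_eq (hPP : P * P = P) (hd : P.trace ≠ 0) {s : ℝ}
    (h : s • P = P * M * P) : s = 1 / P.trace * (P * M).trace := by
  have h := congrArg Matrix.trace h
  rw [Matrix.trace_smul, smul_eq_mul, mul_assoc, Matrix.trace_mul_comm, mul_assoc, hPP,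
    Matrix.trace_mul_comm M] at h
  rw [← h]
  field_simp

end UnitRange

/-! ### Equivalence of the regularity conditions -/

section Conditions

variable {n m : ℕ} {Ω : Set (EuclideanSpace ℝ (Fin n))}
  {H : EuclideanSpace ℝ (Fin n) → Matrix (Fin m) (Fin m) ℝ} {j : Fin m}

/-- A continuous eigenprojection on a connected set has constant rank. -/
theorem exists_trace_eq_of_continuousOn (hΩc : IsConnected Ω) (hH : ∀ x ∈ Ω, (H x).IsSymm)
    (hc : ContinuousOn (fun y => eigproj (H y) j) Ω) :
    ∃ d : ℝ, ∀ y ∈ Ω, (eigproj (H y) j).trace = d := by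
  have hcont : ContinuousOn (fun y => (eigproj (H y) j).trace) Ω :=
    (traceCLM m).continuous.comp_continuousOn hc
  obtain ⟨x₀, hx₀⟩ := hΩc.nonempty
  refine ⟨(eigproj (H x₀) j).trace, fun y hy => ?_⟩
  -- The trace is a multiplicity, so it takes values in the discrete set of natural numbers.
  refine hΩc.isPreconnected.constant_of_mapsTo (T := Set.range (Nat.cast : ℕ → ℝ))
    Nat.isUniformEmbedding_coe_real.isEmbedding.isDiscrete_range hcont ?_ hy hx₀
  intro z hz
  exact ⟨_, (trace_eigproj (hH z hz) j).symm⟩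

theorem exists_trace_eq_of_mem_regConds (hΩc : IsConnected Ω) (hH : ∀ x ∈ Ω, (H x).IsSymm)
    (h : ∃ c ∈ regConds Ω H j, c) : ∃ d : ℝ, ∀ y ∈ Ω, (eigproj (H y) j).trace = d := by
  obtain ⟨c, hc, hc'⟩ := h
  simp only [regConds, List.mem_cons, List.not_mem_nil, or_false] at hc
  rcases hc with rfl | rfl | rfl | rfl
  · exact hc'.2
  · exact hc'.2
  · exact exists_trace_eq_of_continuousOn hΩc hH hc'.continuousOn
  · exact exists_trace_eq_of_continuousOn hΩc hH hc'

/-- The derivative along `e` is `(1 / d) tr (P_j D_e H)`, a product of continuous functions once the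
projection is known to be differentiable. -/
theorem contDiffOn_eigval (hΩo : IsOpen Ω) (hH : ∀ x ∈ Ω, (H x).IsSymm) (hC : ContDiffOn ℝ 1 H Ω)
    {d : ℝ} (hd : ∀ y ∈ Ω, (eigproj (H y) j).trace = d) :
    ContDiffOn ℝ 1 (fun y => eigval (H y) j) Ω := by
  have hdiff : ∀ x ∈ Ω, DifferentiableAt ℝ H x := fun x hx =>
    (hC.differentiableOn one_ne_zero).differentiableAt (hΩo.mem_nhds hx)
  have hs : ∀ x ∈ Ω, ∀ᶠ y in 𝓝 x, (H y).IsSymm := fun x hx => by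
    filter_upwards [hΩo.mem_nhds hx] with y hy using hH y hy
  have htr : ∀ x ∈ Ω, ∀ᶠ y in 𝓝 x, (eigproj (H y) j).trace = (eigproj (H x) j).trace :=
    fun x hx => by filter_upwards [hΩo.mem_nhds hx] with y hy using by rw [hd y hy, hd x hx]
  rw [show (1 : WithTop ℕ∞) = 0 + 1 from (zero_add 1).symm,
    contDiffOn_succ_iff_fderiv_of_isOpen hΩo]
  refine ⟨fun x hx => (differentiableAt_eigval (hdiff x hx) (hs x hx)
    (htr x hx)).differentiableWithinAt, by simp, contDiffOn_zero.2 ?_⟩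
  rw [continuousOn_clm_apply]
  intro e
  have hP : ContinuousOn (fun y => eigproj (H y) j) Ω := fun x hx =>
    (hasFDerivAt_eigproj (hdiff x hx).hasFDerivAt (hs x hx)
      (htr x hx)).continuousAt.continuousWithinAt
  have hH' : ContinuousOn (fun y => fderiv ℝ H y e) Ω :=
    (hC.continuousOn_fderiv_of_isOpen hΩo le_rfl).clm_apply continuousOn_const
  have : ContinuousOn (fun y => 1 / d * traceCLM m (eigproj (H y) j * fderiv ℝ H y e)) Ω :=
    continuousOn_const.mul ((traceCLM m).continuous.comp_continuousOn (hP.mul hH'))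
  refine this.congr fun y hy => ?_
  rw [fderiv_eigval_apply (hdiff y hy) (hs y hy) (htr y hy), hd y hy]
  rfl

/-- From (b) only the constant trace is used to reach (c). Connectedness is needed only to return
from (d) to a constant trace. -/
theorem regConds_tfae (hΩo : IsOpen Ω) (hΩc : IsConnected Ω) (hH : ∀ x ∈ Ω, (H x).IsSymm)
    (hC : ContDiffOn ℝ 1 H Ω) : (regConds Ω H j).TFAE := by
  unfold regConds
  tfae_have 1 → 2 := fun h => ⟨h.1.differentiableOn one_ne_zero, h.2⟩
  tfae_have 2 → 3 := by
    rintro ⟨-, d, hd⟩ x hx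
    refine (hasFDerivAt_eigproj ((hC.differentiableOn one_ne_zero).differentiableAt
      (hΩo.mem_nhds hx)).hasFDerivAt ?_ ?_).differentiableAt.differentiableWithinAt
    · filter_upwards [hΩo.mem_nhds hx] with y hy using hH y hy
    · filter_upwards [hΩo.mem_nhds hx] with y hy using by rw [hd y hy, hd x hx]
  tfae_have 3 → 4 := fun h => h.continuousOn
  tfae_have 4 → 1 := fun h => by
    obtain ⟨d, hd⟩ := exists_trace_eq_of_continuousOn hΩc hH h
    exact ⟨contDiffOn_eigval hΩo hH hC hd, d, hd⟩
  tfae_finish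

end Conditions

/-! ### Algebra of the second order product rule -/

section SecondOrder

variable {m : ℕ}

/-- Compression of the product rule for `μ P = P M P` by `P`. -/
theorem smul_eq_of_product_rule {P A B M M' : Matrix (Fin m) (Fin m) ℝ} {s t : ℝ}
    (hPP : P * P = P) (hPA : P * A = 0) (hAP : A * P = 0)
    (h : s • (A * B * P + P * B * A) + t • P =
      (P * M) * (A * B * P + P * B * A) + (P * M' + (A * B * P + P * B * A) * M) * P) :
    t • P = P * (M' + M * A * B + B * A * M) * P := by
  -- The derivative of a projection has no diagonal block on its range, so the term with the first
  -- derivative `s` drops out.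
  have h0 : P * (A * B * P + P * B * A) * P = 0 := by
    calc _ = P * A * (B * P * P) + P * P * B * (A * P) := by noncomm_ring
      _ = 0 := by rw [hPA, hAP]; simp
  have h1 := congrArg (fun N => P * N * P) h
  have hl : P * (s • (A * B * P + P * B * A) + t • P) * P = t • P := by
    rw [mul_add, add_mul, mul_smul_comm, smul_mul_assoc, h0, smul_zero, zero_add, mul_smul_comm,
      smul_mul_assoc, hPP, hPP]
  rw [hl] at h1
  rw [h1]
  calc _ = (P * P) * M * A * B * (P * P) + (P * P) * M * P * B * (A * P)
        + (P * P) * M' * (P * P) + (P * A) * B * P * M * P * P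
        + (P * P) * B * A * M * (P * P) := by noncomm_ring
    _ = _ := by rw [hPP, hPA, hAP]; noncomm_ring

/-- Lets the two mixed terms, which are transposes of each other, merge into the factor 2. -/
theorem dotProduct_mulVec_transpose (N : Matrix (Fin m) (Fin m) ℝ) (ξ : Fin m → ℝ) :
    ξ ⬝ᵥ (Nᵀ *ᵥ ξ) = ξ ⬝ᵥ (N *ᵥ ξ) := by
  rw [Matrix.mulVec_transpose, dotProduct_comm, Matrix.dotProduct_mulVec]

end SecondOrder

/-! ### Continuity and Hölder continuity of the eigenvalue -/

variable {n m : ℕ} {Ω : Set (EuclideanSpace ℝ (Fin n))}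
  {H : EuclideanSpace ℝ (Fin n) → Matrix (Fin m) (Fin m) ℝ} {j : Fin m} {d : ℝ}

theorem continuousOn_eigval (hH : ∀ x ∈ Ω, (H x).IsSymm) (hC : ContinuousOn H Ω) :
    ContinuousOn (fun y => eigval (H y) j) Ω := by
  have : LipschitzOnWith 1 (fun X : Matrix (Fin m) (Fin m) ℝ => eigval X j) {X | X.IsSymm} :=
    LipschitzOnWith.of_dist_le_mul fun X hX Y hY => by
      rw [Real.dist_eq, dist_eq_norm, NNReal.coe_one, one_mul]
      exact abs_eigval_sub_le hX hY j
  exact this.continuousOn.comp hC hH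

theorem holderOnWith_eigval (hH : ∀ x ∈ Ω, (H x).IsSymm) {C α : ℝ≥0} (hC : HolderOnWith C α H Ω) :
    HolderOnWith C α (fun y => eigval (H y) j) Ω := by
  intro x hx y hy
  refine le_trans ?_ (hC x hx y hy)
  rw [edist_dist, edist_dist, Real.dist_eq, dist_eq_norm]
  exact ENNReal.ofReal_le_ofReal (abs_eigval_sub_le (hH x hx) (hH y hy) j)

theorem eventually_isSymm (hΩo : IsOpen Ω) (hH : ∀ x ∈ Ω, (H x).IsSymm)
    {x : EuclideanSpace ℝ (Fin n)} (hx : x ∈ Ω) : ∀ᶠ y in 𝓝 x, (H y).IsSymm := by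
  filter_upwards [hΩo.mem_nhds hx] with y hy using hH y hy

theorem eventually_trace_eq (hΩo : IsOpen Ω) (hd : ∀ y ∈ Ω, (eigproj (H y) j).trace = d)
    {x : EuclideanSpace ℝ (Fin n)} (hx : x ∈ Ω) :
    ∀ᶠ y in 𝓝 x, (eigproj (H y) j).trace = (eigproj (H x) j).trace := by
  filter_upwards [hΩo.mem_nhds hx] with y hy using by rw [hd y hy, hd x hx]

/-! ### First order formulas and the gradient bound -/

section FirstOrder

variable {x : EuclideanSpace ℝ (Fin n)}

theorem dirD_eq_fderiv
    (hΩo : IsOpen Ω) (hC : DifferentiableOn ℝ H Ω) (hx : x ∈ Ω)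
    (e : EuclideanSpace ℝ (Fin n)) : dirD e H x = fderiv ℝ H x e :=
  (hC.differentiableAt (hΩo.mem_nhds hx)).lineDeriv_eq_fderiv

theorem differentiableAt_eigval_of_trace_eq
    (hΩo : IsOpen Ω) (hH : ∀ x ∈ Ω, (H x).IsSymm) (hC : DifferentiableOn ℝ H Ω)
    (hd : ∀ y ∈ Ω, (eigproj (H y) j).trace = d) (hx : x ∈ Ω) :
    DifferentiableAt ℝ (fun y => eigval (H y) j) x :=
  differentiableAt_eigval (hC.differentiableAt (hΩo.mem_nhds hx)) (eventually_isSymm hΩo hH hx)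
    (eventually_trace_eq hΩo hd hx)

theorem lineDeriv_eigval_smul
    (hΩo : IsOpen Ω) (hH : ∀ x ∈ Ω, (H x).IsSymm) (hC : DifferentiableOn ℝ H Ω)
    (hd : ∀ y ∈ Ω, (eigproj (H y) j).trace = d) (hx : x ∈ Ω)
    (e : EuclideanSpace ℝ (Fin n)) :
    lineDeriv ℝ (fun y => eigval (H y) j) x e • eigproj (H x) j =
      eigproj (H x) j * dirD e H x * eigproj (H x) j := by
  rw [dirD_eq_fderiv hΩo hC hx,
    (differentiableAt_eigval_of_trace_eq hΩo hH hC hd hx).lineDeriv_eq_fderiv]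
  exact fderiv_eigval_smul (hC.differentiableAt (hΩo.mem_nhds hx)) (eventually_isSymm hΩo hH hx)
    (eventually_trace_eq hΩo hd hx) e

theorem lineDeriv_eigval_eq_trace
    (hΩo : IsOpen Ω) (hH : ∀ x ∈ Ω, (H x).IsSymm) (hC : DifferentiableOn ℝ H Ω)
    (hd : ∀ y ∈ Ω, (eigproj (H y) j).trace = d) (hx : x ∈ Ω)
    (e : EuclideanSpace ℝ (Fin n)) :
    lineDeriv ℝ (fun y => eigval (H y) j) x e =
      1 / (eigproj (H x) j).trace * (eigproj (H x) j * dirD e H x).trace :=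
  eq_trace_of_smul_eq (eigproj_mul_self (hH x hx) j) (trace_eigproj_pos (hH x hx) j).ne'
    (lineDeriv_eigval_smul hΩo hH hC hd hx e)

theorem lineDeriv_eigval_eq_dotProduct
    (hΩo : IsOpen Ω) (hH : ∀ x ∈ Ω, (H x).IsSymm) (hC : DifferentiableOn ℝ H Ω)
    (hd : ∀ y ∈ Ω, (eigproj (H y) j).trace = d) (hx : x ∈ Ω)
    (e : EuclideanSpace ℝ (Fin n)) {ξ : Fin m → ℝ}
    (hξ : ξ ∈ unitRange (eigproj (H x) j)) :
    lineDeriv ℝ (fun y => eigval (H y) j) x e = ξ ⬝ᵥ (dirD e H x *ᵥ ξ) :=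
  eq_dotProduct_of_smul_eq (eigproj_transpose (hH x hx) j) (eigproj_mul_self (hH x hx) j) hξ
    (lineDeriv_eigval_smul hΩo hH hC hd hx e)

theorem jacDeriv_mulVec_eq_dirD
    (hΩo : IsOpen Ω) (hC : DifferentiableOn ℝ H Ω) (hx : x ∈ Ω)
    (e : EuclideanSpace ℝ (Fin n)) (ξ : Fin m → ℝ) :
    jacDeriv ξ H x *ᵥ e.ofLp = dirD e H x *ᵥ ξ := by
  rw [jacDeriv_mulVec (hC.differentiableAt (hΩo.mem_nhds hx)), dirD_eq_fderiv hΩo hC hx]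

theorem inner_eq_dotProduct (a b : EuclideanSpace ℝ (Fin n)) :
    inner ℝ a b = a.ofLp ⬝ᵥ b.ofLp := by
  rw [EuclideanSpace.inner_eq_star_dotProduct, dotProduct_comm]
  simp

theorem inner_gradient_eq_lineDeriv {f : EuclideanSpace ℝ (Fin n) → ℝ}
    (hf : DifferentiableAt ℝ f x) (e : EuclideanSpace ℝ (Fin n)) :
    inner ℝ (gradient f x) e = lineDeriv ℝ f x e := by
  rw [hf.lineDeriv_eq_fderiv, gradient, InnerProductSpace.toDual_symm_apply]

theorem gradient_eigval_eq
    (hΩo : IsOpen Ω) (hH : ∀ x ∈ Ω, (H x).IsSymm) (hC : DifferentiableOn ℝ H Ω)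
    (hd : ∀ y ∈ Ω, (eigproj (H y) j).trace = d) (hx : x ∈ Ω)
    {ξ : Fin m → ℝ} (hξ : ξ ∈ unitRange (eigproj (H x) j)) :
    (gradient (fun y => eigval (H y) j) x).ofLp = ξ ᵥ* jacDeriv ξ H x := by
  ext l
  have h := inner_gradient_eq_lineDeriv
    (differentiableAt_eigval_of_trace_eq hΩo hH hC hd hx) (EuclideanSpace.single l 1)
  rw [lineDeriv_eigval_eq_dotProduct hΩo hH hC hd hx _ hξ,
    ← jacDeriv_mulVec_eq_dirD hΩo hC hx, Matrix.dotProduct_mulVec, inner_eq_dotProduct] at h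
  simpa using h

/-- In the direction `e` of the gradient, its length is `tr (P D_e H) / d`, and Cauchy–Schwarz with
`‖P‖ = √d` gives the bound. -/
theorem norm_gradient_eigval_le
    (hΩo : IsOpen Ω) (hH : ∀ x ∈ Ω, (H x).IsSymm) (hC : DifferentiableOn ℝ H Ω)
    (hd : ∀ y ∈ Ω, (eigproj (H y) j).trace = d) (hx : x ∈ Ω) :
    ‖gradient (fun y => eigval (H y) j) x‖ ≤ 1 / √(eigproj (H x) j).trace *
      sSup ((fun e => ‖dirD e H x‖) '' Metric.sphere (0 : EuclideanSpace ℝ (Fin n)) 1) := by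
  set g := gradient (fun y => eigval (H y) j) x with hg
  have hdpos := trace_eigproj_pos (hH x hx) j
  have hS : 0 ≤ sSup ((fun e => ‖dirD e H x‖) ''
      Metric.sphere (0 : EuclideanSpace ℝ (Fin n)) 1) := by
    apply Real.sSup_nonneg
    rintro _ ⟨e, -, rfl⟩
    exact norm_nonneg _
  -- This case also absorbs `n = 0`, where the sphere is empty and `sSup ∅ = 0`.
  rcases eq_or_ne g 0 with h0 | h0
  · rw [h0, norm_zero]
    positivity
  have hgn : ‖g‖ ≠ 0 := norm_ne_zero_iff.2 h0
  set e := ‖g‖⁻¹ • g with he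
  have hen : ‖e‖ = 1 := by rw [he, norm_smul, norm_inv, norm_norm, inv_mul_cancel₀ hgn]
  have h1 : inner ℝ g e = ‖g‖ := by
    rw [he, inner_smul_right, real_inner_self_eq_norm_sq]
    field_simp
  have hbdd : BddAbove ((fun e => ‖dirD e H x‖) ''
      Metric.sphere (0 : EuclideanSpace ℝ (Fin n)) 1) := by
    refine (isCompact_sphere _ _).bddAbove_image (Continuous.continuousOn ?_)
    have : (fun e => ‖dirD e H x‖) = fun e => ‖fderiv ℝ H x e‖ := by
      ext e
      rw [dirD_eq_fderiv hΩo hC hx]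
    rw [this]
    exact (fderiv ℝ H x).continuous.norm
  have h2 : ‖dirD e H x‖ ≤ sSup ((fun e => ‖dirD e H x‖) ''
      Metric.sphere (0 : EuclideanSpace ℝ (Fin n)) 1) :=
    le_csSup hbdd ⟨e, by simpa using hen, rfl⟩
  have hsymm : (dirD e H x)ᵀ = dirD e H x := by
    rw [dirD_eq_fderiv hΩo hC hx]
    exact isSymm_fderiv_apply (hC.differentiableAt (hΩo.mem_nhds hx))
      (eventually_isSymm hΩo hH hx) e
  have h3 : (eigproj (H x) j * dirD e H x).trace ≤ √(eigproj (H x) j).trace * ‖dirD e H x‖ := by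
    have := trace_mul_transpose_le (eigproj (H x) j) (dirD e H x)
    rwa [hsymm, norm_eigproj (hH x hx)] at this
  rw [← h1, hg, inner_gradient_eq_lineDeriv (differentiableAt_eigval_of_trace_eq hΩo hH hC hd hx),
    lineDeriv_eigval_eq_trace hΩo hH hC hd hx]
  calc _ ≤ 1 / (eigproj (H x) j).trace * (√(eigproj (H x) j).trace * ‖dirD e H x‖) := by gcongr
    _ = 1 / √(eigproj (H x) j).trace * ‖dirD e H x‖ := by
        rw [← mul_assoc]
        congr 1
        have := Real.sqrt_pos.2 hdpos
        field_simp
        exact Real.sq_sqrt hdpos.le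
    _ ≤ _ := by gcongr

end FirstOrder

theorem differentiableAt_fderiv_apply {V W : Type*} [NormedAddCommGroup V] [NormedSpace ℝ V]
    [NormedAddCommGroup W] [NormedSpace ℝ W] {f : V → W} {s : Set V} (hs : IsOpen s)
    (hf : ContDiffOn ℝ 2 f s) {x : V} (hx : x ∈ s) (a : V) :
    DifferentiableAt ℝ (fun y => fderiv ℝ f y a) x := by
  have h1 : ContDiffOn ℝ 1 (fderiv ℝ f) s := hf.fderiv_of_isOpen hs (by norm_num)
  exact ((h1.differentiableOn one_ne_zero).differentiableAt (hs.mem_nhds hx)).clm_apply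
    (differentiableAt_const a)

/-! ### Second derivatives and the Hessian -/

section SecondOrder

variable {x : EuclideanSpace ℝ (Fin n)}

theorem differentiableAt_dirD
    (hΩo : IsOpen Ω) (hC : ContDiffOn ℝ 2 H Ω) (hx : x ∈ Ω)
    (a : EuclideanSpace ℝ (Fin n)) : DifferentiableAt ℝ (dirD a H) x := by
  refine (differentiableAt_fderiv_apply hΩo hC hx a).congr_of_eventuallyEq ?_
  filter_upwards [hΩo.mem_nhds hx] with y hy
  exact dirD_eq_fderiv hΩo (hC.differentiableOn two_ne_zero) hy a

/-- Near `x` the first derivative equals `(1 / d) tr (P_j D_a H)`, whose factors are both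
differentiable. -/
theorem differentiableAt_lineDeriv_eigval
    (hΩo : IsOpen Ω) (hH : ∀ x ∈ Ω, (H x).IsSymm) (hC : ContDiffOn ℝ 2 H Ω)
    (hd : ∀ y ∈ Ω, (eigproj (H y) j).trace = d) (hx : x ∈ Ω)
    (a : EuclideanSpace ℝ (Fin n)) :
    DifferentiableAt ℝ (fun y => lineDeriv ℝ (fun z => eigval (H z) j) y a) x := by
  have hC1 : DifferentiableOn ℝ H Ω := hC.differentiableOn two_ne_zero
  have hP := (hasFDerivAt_eigproj (hC1.differentiableAt (hΩo.mem_nhds hx)).hasFDerivAt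
    (eventually_isSymm hΩo hH hx) (eventually_trace_eq hΩo hd hx)).differentiableAt
  have h : DifferentiableAt ℝ (fun y => 1 / d * traceCLM m (eigproj (H y) j * dirD a H y)) x :=
    ((traceCLM m).differentiableAt.comp x
      (hP.fun_mul (differentiableAt_dirD hΩo hC hx a))).const_mul _
  refine h.congr_of_eventuallyEq ?_
  filter_upwards [hΩo.mem_nhds hx] with y hy
  rw [lineDeriv_eigval_eq_trace hΩo hH hC1 hd hy, hd y hy]
  rfl

/-- Differentiate `D_a λ P = P D_a H P` along `b`, insert the derivative of the projection, and
compress by `P`. -/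
theorem lineDeriv_lineDeriv_eigval_smul
    (hΩo : IsOpen Ω) (hH : ∀ x ∈ Ω, (H x).IsSymm) (hC : ContDiffOn ℝ 2 H Ω)
    (hd : ∀ y ∈ Ω, (eigproj (H y) j).trace = d) (hx : x ∈ Ω)
    (a b : EuclideanSpace ℝ (Fin n)) :
    lineDeriv ℝ (fun y => lineDeriv ℝ (fun z => eigval (H z) j) y a) x b • eigproj (H x) j =
      eigproj (H x) j * (dirD b (dirD a H) x + dirD a H x * pinv (H x) j * dirD b H x
        + dirD b H x * pinv (H x) j * dirD a H x) * eigproj (H x) j := by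
  have hC1 : DifferentiableOn ℝ H Ω := hC.differentiableOn two_ne_zero
  have hHx := hC1.differentiableAt (hΩo.mem_nhds hx)
  have hP := (hasFDerivAt_eigproj hHx.hasFDerivAt
    (eventually_isSymm hΩo hH hx) (eventually_trace_eq hΩo hd hx)).differentiableAt
  have hP' := fderiv_eigproj_apply hHx (eventually_isSymm hΩo hH hx)
    (eventually_trace_eq hΩo hd hx) b
  have hM := differentiableAt_dirD hΩo hC hx a
  have hl := differentiableAt_lineDeriv_eigval hΩo hH hC hd hx a
  have h1 := hl.hasFDerivAt.smul hP.hasFDerivAt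
  have h2 := (hP.hasFDerivAt.mul' hM.hasFDerivAt).mul' hP.hasFDerivAt
  have h3 := h2.congr_of_eventuallyEq
    (f₁ := fun y => lineDeriv ℝ (fun z => eigval (H z) j) y a • eigproj (H y) j) (by
      filter_upwards [hΩo.mem_nhds hx] with y hy using lineDeriv_eigval_smul hΩo hH hC1 hd hy a)
  have h4 := congrArg (fun L : EuclideanSpace ℝ (Fin n) →L[ℝ] Matrix (Fin m) (Fin m) ℝ => L b)
    (h1.unique h3)
  change lineDeriv ℝ (fun z => eigval (H z) j) x a • fderiv ℝ (fun y => eigproj (H y) j) x b +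
      fderiv ℝ (fun y => lineDeriv ℝ (fun z => eigval (H z) j) y a) x b • eigproj (H x) j =
    (eigproj (H x) j * dirD a H x) * fderiv ℝ (fun y => eigproj (H y) j) x b +
      (eigproj (H x) j * fderiv ℝ (dirD a H) x b +
        fderiv ℝ (fun y => eigproj (H y) j) x b * dirD a H x) * eigproj (H x) j at h4
  rw [hP', ← dirD_eq_fderiv hΩo hC1 hx] at h4
  rw [hl.lineDeriv_eq_fderiv, show dirD b (dirD a H) x = fderiv ℝ (dirD a H) x b from
    hM.lineDeriv_eq_fderiv]
  exact smul_eq_of_product_rule (eigproj_mul_self (hH x hx) j) (eigproj_mul_pinv (hH x hx) j)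
    (pinv_mul_eigproj (hH x hx) j) h4

theorem transpose_dirD_mul_pinv_mul_dirD
    (hΩo : IsOpen Ω) (hH : ∀ x ∈ Ω, (H x).IsSymm) (hC : ContDiffOn ℝ 2 H Ω) (hx : x ∈ Ω)
    (a b : EuclideanSpace ℝ (Fin n)) :
    (dirD a H x * pinv (H x) j * dirD b H x)ᵀ = dirD b H x * pinv (H x) j * dirD a H x := by
  have hC1 : DifferentiableOn ℝ H Ω := hC.differentiableOn two_ne_zero
  have hsymm : ∀ e, (dirD e H x)ᵀ = dirD e H x := fun e => by
    rw [dirD_eq_fderiv hΩo hC1 hx]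
    exact isSymm_fderiv_apply (hC1.differentiableAt (hΩo.mem_nhds hx))
      (eventually_isSymm hΩo hH hx) e
  rw [Matrix.transpose_mul, Matrix.transpose_mul, hsymm, hsymm, pinv_transpose (hH x hx), mul_assoc]

theorem lineDeriv_lineDeriv_eigval_eq_trace
    (hΩo : IsOpen Ω) (hH : ∀ x ∈ Ω, (H x).IsSymm) (hC : ContDiffOn ℝ 2 H Ω)
    (hd : ∀ y ∈ Ω, (eigproj (H y) j).trace = d) (hx : x ∈ Ω)
    (a b : EuclideanSpace ℝ (Fin n)) :
    lineDeriv ℝ (fun y => lineDeriv ℝ (fun z => eigval (H z) j) y a) x b =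
      1 / (eigproj (H x) j).trace * (eigproj (H x) j * (dirD b (dirD a H) x
        + (2 : ℝ) • (dirD a H x * pinv (H x) j * dirD b H x))).trace := by
  rw [eq_trace_of_smul_eq (eigproj_mul_self (hH x hx) j) (trace_eigproj_pos (hH x hx) j).ne'
    (lineDeriv_lineDeriv_eigval_smul hΩo hH hC hd hx a b)]
  have h : (eigproj (H x) j * (dirD b H x * pinv (H x) j * dirD a H x)).trace =
      (eigproj (H x) j * (dirD a H x * pinv (H x) j * dirD b H x)).trace := by
    rw [← Matrix.trace_transpose, Matrix.transpose_mul, eigproj_transpose (hH x hx),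
      transpose_dirD_mul_pinv_mul_dirD hΩo hH hC hx, Matrix.trace_mul_comm]
  rw [two_smul]
  simp only [Matrix.mul_add, Matrix.trace_add, h]
  ring

theorem lineDeriv_lineDeriv_eigval_eq_dotProduct
    (hΩo : IsOpen Ω) (hH : ∀ x ∈ Ω, (H x).IsSymm) (hC : ContDiffOn ℝ 2 H Ω)
    (hd : ∀ y ∈ Ω, (eigproj (H y) j).trace = d) (hx : x ∈ Ω)
    (a b : EuclideanSpace ℝ (Fin n)) {ξ : Fin m → ℝ}
    (hξ : ξ ∈ unitRange (eigproj (H x) j)) :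
    lineDeriv ℝ (fun y => lineDeriv ℝ (fun z => eigval (H z) j) y a) x b =
      ξ ⬝ᵥ ((dirD b (dirD a H) x
        + (2 : ℝ) • (dirD a H x * pinv (H x) j * dirD b H x)) *ᵥ ξ) := by
  rw [eq_dotProduct_of_smul_eq (eigproj_transpose (hH x hx) j) (eigproj_mul_self (hH x hx) j) hξ
    (lineDeriv_lineDeriv_eigval_smul hΩo hH hC hd hx a b)]
  have h := dotProduct_mulVec_transpose (dirD a H x * pinv (H x) j * dirD b H x) ξ
  rw [transpose_dirD_mul_pinv_mul_dirD hΩo hH hC hx] at h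
  rw [Matrix.add_mulVec, Matrix.add_mulVec, Matrix.add_mulVec, dotProduct_add, dotProduct_add,
    dotProduct_add, h, two_smul, Matrix.add_mulVec, dotProduct_add]
  ring

/-- Since `∇_ξ H e = D_e H ξ`, pairing `(∇_ξ H)ᵀ ξ` with a fixed `a` gives `ξᵀ D_a H ξ` throughout
`Ω`, which can then be differentiated along `b`. -/
theorem dotProduct_hessForm_mulVec
    (hΩo : IsOpen Ω) (hH : ∀ x ∈ Ω, (H x).IsSymm) (hC : ContDiffOn ℝ 2 H Ω) (hx : x ∈ Ω)
    (a b : EuclideanSpace ℝ (Fin n)) (ξ : Fin m → ℝ) :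
    a.ofLp ⬝ᵥ (hessForm H j ξ x *ᵥ b.ofLp) =
      ξ ⬝ᵥ ((dirD b (dirD a H) x
        + (2 : ℝ) • (dirD a H x * pinv (H x) j * dirD b H x)) *ᵥ ξ) := by
  have hC1 : DifferentiableOn ℝ H Ω := hC.differentiableOn two_ne_zero
  have hval : ∀ y ∈ Ω, ∀ e : EuclideanSpace ℝ (Fin n),
      e.ofLp ⬝ᵥ ((jacDeriv ξ H y)ᵀ *ᵥ ξ) = quadCLM ξ (dirD e H y) := fun y hy e => by
    rw [Matrix.mulVec_transpose, dotProduct_comm, ← Matrix.dotProduct_mulVec,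
      jacDeriv_mulVec_eq_dirD hΩo hC1 hy]
    rfl
  have hquad : ∀ e, HasFDerivAt (fun y => quadCLM ξ (dirD e H y))
      ((quadCLM ξ).comp (fderiv ℝ (dirD e H) x)) x := fun e =>
    (quadCLM ξ).hasFDerivAt.comp x (differentiableAt_dirD hΩo hC hx e).hasFDerivAt
  -- `jacobian` is built on `fderiv`, whose default value is zero, so differentiability must be
  -- secured first; it is checked by components.
  have hG : DifferentiableAt ℝ (fun y => WithLp.toLp 2 ((jacDeriv ξ H y)ᵀ *ᵥ ξ)) x := by
    rw [differentiableAt_euclidean]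
    intro l
    refine (hquad (EuclideanSpace.single l 1)).differentiableAt.congr_of_eventuallyEq ?_
    filter_upwards [hΩo.mem_nhds hx] with y hy
    rw [← hval y hy]
    simp
  have h1 : a.ofLp ⬝ᵥ (jacDeriv ξ (fun y => (jacDeriv ξ H y)ᵀ) x *ᵥ b.ofLp) =
      ξ ⬝ᵥ (dirD b (dirD a H) x *ᵥ ξ) := by
    have h := (hquad a).congr_of_eventuallyEq
      (f₁ := fun y => a.ofLp ⬝ᵥ (WithLp.toLp 2 ((jacDeriv ξ H y)ᵀ *ᵥ ξ)).ofLp) (by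
        filter_upwards [hΩo.mem_nhds hx] with y hy using hval y hy a)
    rw [jacDeriv, dotProduct_jacobian_mulVec hG, h.fderiv,
      show dirD b (dirD a H) x = fderiv ℝ (dirD a H) x b from
        (differentiableAt_dirD hΩo hC hx a).lineDeriv_eq_fderiv]
    rfl
  have hsymm : (dirD a H x)ᵀ = dirD a H x := by
    rw [dirD_eq_fderiv hΩo hC1 hx]
    exact isSymm_fderiv_apply (hC1.differentiableAt (hΩo.mem_nhds hx))
      (eventually_isSymm hΩo hH hx) a
  have h2 : a.ofLp ⬝ᵥ (((jacDeriv ξ H x)ᵀ * pinv (H x) j * jacDeriv ξ H x) *ᵥ b.ofLp) =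
      ξ ⬝ᵥ ((dirD a H x * pinv (H x) j * dirD b H x) *ᵥ ξ) := by
    rw [← Matrix.mulVec_mulVec, ← Matrix.mulVec_mulVec, jacDeriv_mulVec_eq_dirD hΩo hC1 hx,
      Matrix.dotProduct_mulVec, Matrix.vecMul_transpose, jacDeriv_mulVec_eq_dirD hΩo hC1 hx,
      ← Matrix.mulVec_mulVec, ← Matrix.mulVec_mulVec, Matrix.dotProduct_mulVec ξ,
      ← Matrix.mulVec_transpose, hsymm]
  rw [hessForm, Matrix.add_mulVec, dotProduct_add, h1, Matrix.smul_mulVec, dotProduct_smul, h2,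
    Matrix.add_mulVec, dotProduct_add, Matrix.smul_mulVec, dotProduct_smul]

theorem differentiableAt_gradient_eigval
    (hΩo : IsOpen Ω) (hH : ∀ x ∈ Ω, (H x).IsSymm) (hC : ContDiffOn ℝ 2 H Ω)
    (hd : ∀ y ∈ Ω, (eigproj (H y) j).trace = d) (hx : x ∈ Ω) :
    DifferentiableAt ℝ (gradient fun y => eigval (H y) j) x := by
  rw [differentiableAt_euclidean]
  intro l
  refine (differentiableAt_lineDeriv_eigval hΩo hH hC hd hx
    (EuclideanSpace.single l 1)).congr_of_eventuallyEq ?_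
  filter_upwards [hΩo.mem_nhds hx] with y hy
  rw [← inner_gradient_eq_lineDeriv (differentiableAt_eigval_of_trace_eq hΩo hH
    (hC.differentiableOn two_ne_zero) hd hy), inner_eq_dotProduct]
  simp

theorem dotProduct_jacobian_gradient_eigval
    (hΩo : IsOpen Ω) (hH : ∀ x ∈ Ω, (H x).IsSymm) (hC : ContDiffOn ℝ 2 H Ω)
    (hd : ∀ y ∈ Ω, (eigproj (H y) j).trace = d) (hx : x ∈ Ω)
    (a b : EuclideanSpace ℝ (Fin n)) :
    a.ofLp ⬝ᵥ (jacobian (gradient fun y => eigval (H y) j) x *ᵥ b.ofLp) =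
      lineDeriv ℝ (fun y => lineDeriv ℝ (fun z => eigval (H z) j) y a) x b := by
  rw [dotProduct_jacobian_mulVec (differentiableAt_gradient_eigval hΩo hH hC hd hx),
    (differentiableAt_lineDeriv_eigval hΩo hH hC hd hx a).lineDeriv_eq_fderiv]
  congr 1
  refine Filter.EventuallyEq.fderiv_eq ?_
  filter_upwards [hΩo.mem_nhds hx] with y hy
  rw [← inner_gradient_eq_lineDeriv (differentiableAt_eigval_of_trace_eq hΩo hH
    (hC.differentiableOn two_ne_zero) hd hy), inner_eq_dotProduct, dotProduct_comm]

theorem jacobian_gradient_eigval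
    (hΩo : IsOpen Ω) (hH : ∀ x ∈ Ω, (H x).IsSymm) (hC : ContDiffOn ℝ 2 H Ω)
    (hd : ∀ y ∈ Ω, (eigproj (H y) j).trace = d) (hx : x ∈ Ω)
    {ξ : Fin m → ℝ} (hξ : ξ ∈ unitRange (eigproj (H x) j)) :
    jacobian (gradient fun y => eigval (H y) j) x = hessForm H j ξ x :=
  eq_of_dotProduct_mulVec_eq fun a b => by
    rw [dotProduct_jacobian_gradient_eigval hΩo hH hC hd hx,
      dotProduct_hessForm_mulVec hΩo hH hC hx,
      lineDeriv_lineDeriv_eigval_eq_dotProduct hΩo hH hC hd hx a b hξ]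

end SecondOrder

end EigReg

/-! ### Assembly of the theorem -/

theorem theorem4p6 {n m : ℕ} (Ω : Set (EuclideanSpace ℝ (Fin n)))
    (hΩo : IsOpen Ω) (hΩc : IsConnected Ω)
    (H : EuclideanSpace ℝ (Fin n) → Matrix (Fin m) (Fin m) ℝ)
    (hH : ∀ x ∈ Ω, (H x).IsSymm) (j : Fin m)
    (lam : EuclideanSpace ℝ (Fin n) → ℝ) (hlam : lam = fun x => eigval (H x) j)
    (P A : EuclideanSpace ℝ (Fin n) → Matrix (Fin m) (Fin m) ℝ)
    (hP : P = fun x => eigproj (H x) j) (hA : A = fun x => pinv (H x) j) :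
    -- (A)
    (ContinuousOn H Ω →
      ContinuousOn lam Ω ∧
      ∀ α C : ℝ≥0, 0 < α → α ≤ 1 → HolderOnWith C α H Ω → HolderOnWith C α lam Ω) ∧
    -- (B)
    (ContDiffOn ℝ 1 H Ω →
      -- (i)
      (∀ d : ℝ, (∀ x ∈ Ω, (P x).trace = d) → ∀ x ∈ Ω, ∀ e,
        LineDifferentiableAt ℝ lam x e ∧
        lineDeriv ℝ lam x e • P x = P x * dirD e H x * P x ∧
        lineDeriv ℝ lam x e = 1 / d * (P x * dirD e H x).trace ∧
        ∀ ξ ∈ unitRange (P x),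
          lineDeriv ℝ lam x e = ξ ⬝ᵥ (dirD e H x *ᵥ ξ) ∧
          lineDeriv ℝ lam x e = ξ ⬝ᵥ (jacDeriv ξ H x *ᵥ e.ofLp)) ∧
      -- (ii)
      (regConds Ω H j).TFAE ∧
      ((∃ c ∈ regConds Ω H j, c) → ∀ x ∈ Ω,
        DifferentiableAt ℝ lam x ∧
        ‖gradient lam x‖ ≤ 1 / √(P x).trace *
          sSup ((fun e => ‖dirD e H x‖) '' Metric.sphere (0 : EuclideanSpace ℝ (Fin n)) 1) ∧
        (∀ ξ ∈ unitRange (P x), (gradient lam x).ofLp = ξ ᵥ* jacDeriv ξ H x) ∧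
        ∀ e, inner ℝ (gradient lam x) e = lineDeriv ℝ lam x e ∧
          lineDeriv ℝ lam x e = 1 / (P x).trace * (P x * dirD e H x).trace)) ∧
    -- (C)
    (ContDiffOn ℝ 2 H Ω →
      -- (i)
      (∀ a : EuclideanSpace ℝ (Fin n), ∀ d : ℝ, (∀ x ∈ Ω, (P x).trace = d) →
        (∀ x ∈ Ω, LineDifferentiableAt ℝ lam x a) ∧
        ∀ x ∈ Ω, ∀ b,
          LineDifferentiableAt ℝ (fun y => lineDeriv ℝ lam y a) x b ∧
          lineDeriv ℝ (fun y => lineDeriv ℝ lam y a) x b • P x =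
            P x * (dirD b (dirD a H) x + dirD a H x * A x * dirD b H x
              + dirD b H x * A x * dirD a H x) * P x ∧
          lineDeriv ℝ (fun y => lineDeriv ℝ lam y a) x b =
            1 / d * (P x * (dirD b (dirD a H) x
              + (2 : ℝ) • (dirD a H x * A x * dirD b H x))).trace ∧
          ∀ ξ ∈ unitRange (P x),
            lineDeriv ℝ (fun y => lineDeriv ℝ lam y a) x b =
              ξ ⬝ᵥ ((dirD b (dirD a H) x + (2 : ℝ) • (dirD a H x * A x * dirD b H x)) *ᵥ ξ) ∧
            lineDeriv ℝ (fun y => lineDeriv ℝ lam y a) x b =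
              a.ofLp ⬝ᵥ (hessForm H j ξ x *ᵥ b.ofLp)) ∧
      -- (ii)
      ((∃ c ∈ regConds Ω H j, c) → ∀ x ∈ Ω,
        DifferentiableAt ℝ lam x ∧
        DifferentiableAt ℝ (gradient lam) x ∧
        (∀ ξ ∈ unitRange (P x), jacobian (gradient lam) x = hessForm H j ξ x) ∧
        ∀ a b : EuclideanSpace ℝ (Fin n),
          LineDifferentiableAt ℝ (fun y => lineDeriv ℝ lam y a) x b ∧
          a.ofLp ⬝ᵥ (jacobian (gradient lam) x *ᵥ b.ofLp) =
            lineDeriv ℝ (fun y => lineDeriv ℝ lam y a) x b ∧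
          lineDeriv ℝ (fun y => lineDeriv ℝ lam y a) x b =
            1 / (P x).trace * (P x * (dirD b (dirD a H) x
              + (2 : ℝ) • (dirD a H x * A x * dirD b H x))).trace)) := by
  subst hlam hP hA
  refine ⟨fun hC => ⟨continuousOn_eigval hH hC, fun α C _ _ hα => holderOnWith_eigval hH hα⟩,
    fun hC => ?_, fun hC => ?_⟩
  · have hC1 : DifferentiableOn ℝ H Ω := hC.differentiableOn one_ne_zero
    refine ⟨fun d hd x hx e => ⟨?_, ?_, ?_, fun ξ hξ => ⟨?_, ?_⟩⟩, regConds_tfae hΩo hΩc hH hC,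
      fun hreg x hx => ?_⟩
    · exact (differentiableAt_eigval_of_trace_eq hΩo hH hC1 hd hx).lineDifferentiableAt
    · exact lineDeriv_eigval_smul hΩo hH hC1 hd hx e
    · rw [← hd x hx]
      exact lineDeriv_eigval_eq_trace hΩo hH hC1 hd hx e
    · exact lineDeriv_eigval_eq_dotProduct hΩo hH hC1 hd hx e hξ
    · rw [jacDeriv_mulVec_eq_dirD hΩo hC1 hx]
      exact lineDeriv_eigval_eq_dotProduct hΩo hH hC1 hd hx e hξ
    · obtain ⟨d, hd⟩ := exists_trace_eq_of_mem_regConds hΩc hH hreg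
      have hdiff := differentiableAt_eigval_of_trace_eq hΩo hH hC1 hd hx
      exact ⟨hdiff, norm_gradient_eigval_le hΩo hH hC1 hd hx,
        fun ξ hξ => gradient_eigval_eq hΩo hH hC1 hd hx hξ,
        fun e => ⟨inner_gradient_eq_lineDeriv hdiff e,
          lineDeriv_eigval_eq_trace hΩo hH hC1 hd hx e⟩⟩
  · have hC1 : DifferentiableOn ℝ H Ω := hC.differentiableOn two_ne_zero
    refine ⟨fun a d hd => ⟨fun x hx => ?_, fun x hx b => ⟨?_, ?_, ?_, fun ξ hξ => ⟨?_, ?_⟩⟩⟩,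
      fun hreg x hx => ?_⟩
    · exact (differentiableAt_eigval_of_trace_eq hΩo hH hC1 hd hx).lineDifferentiableAt
    · exact (differentiableAt_lineDeriv_eigval hΩo hH hC hd hx a).lineDifferentiableAt
    · exact lineDeriv_lineDeriv_eigval_smul hΩo hH hC hd hx a b
    · rw [← hd x hx]
      exact lineDeriv_lineDeriv_eigval_eq_trace hΩo hH hC hd hx a b
    · exact lineDeriv_lineDeriv_eigval_eq_dotProduct hΩo hH hC hd hx a b hξ
    · rw [dotProduct_hessForm_mulVec hΩo hH hC hx]
      exact lineDeriv_lineDeriv_eigval_eq_dotProduct hΩo hH hC hd hx a b hξ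
    · obtain ⟨d, hd⟩ := exists_trace_eq_of_mem_regConds hΩc hH hreg
      exact ⟨differentiableAt_eigval_of_trace_eq hΩo hH hC1 hd hx,
        differentiableAt_gradient_eigval hΩo hH hC hd hx,
        fun ξ hξ => jacobian_gradient_eigval hΩo hH hC hd hx hξ,
        fun a b => ⟨(differentiableAt_lineDeriv_eigval hΩo hH hC hd hx a).lineDifferentiableAt,
          dotProduct_jacobian_gradient_eigval hΩo hH hC hd hx a b,
          lineDeriv_lineDeriv_eigval_eq_trace hΩo hH hC hd hx a b⟩⟩
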